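/- For $q\in(0,1)$, let $\mathcal U_q$ be the set of $q$-admissible controls $u=(u_i)_{i\ge 0}$ of a lazy simple random walk $(S_i^u)_{i\ge 0}$ on $\mathbb Z$: that is, $S_0^u=0$, and, with $\mathcal F_i=\sigma(S_0^u,\dots,S_i^u)$, each $u_i$ is an $\mathcal F_i$-measurable random variable with $u_i\in[0,q]$ almost surely, and $$P(S_{i+1}^u=S_i^u\mid\mathcal F_i)=u_i,\qquad P(S_{i+1}^u=S_i^u+1\mid\mathcal F_i)=P(S_{i+1}^u=S_i^u-1\mid\mathcal F_i)=\frac{1-u_i}{2}\qquad\text{a.s. for all } i\ge 0 .$$ There exist functions $\sigma_+,\sigma_-:(0,1)\to(0,1/2)$ such that for every $q\in(0,1)$ there are constants $c,C\in(0,\infty)$, which may depend on $q$, such that for every integer $n\ge 1$ $$c\,n^{-\sigma_-(q)}<\sup_{u\in\mathcal U_q}P(S_n^u=0)<C\,n^{-\sigma_+(q)},$$ and moreover $\sigma_-(q)\to 0$ as $q\nearrow 1$. -/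

import Mathlib

open MeasureTheory ProbabilityTheory Filter Topology

/-- `S : ℕ → Ω → ℤ` is a simple random walk on `(Ω, μ)`, started at `0` and controlled by the
`q`-admissible control `u : ℕ → Ω → ℝ`. The filtration is the one generated by the walk itself,
`ℱ i = σ(S 0, …, S i)`. -/
structure IsControlledWalk {Ω : Type*} [MeasurableSpace Ω] (μ : Measure Ω) (q : ℝ)
    (u : ℕ → Ω → ℝ) (S : ℕ → Ω → ℤ) : Prop where
  /-- every `S i` is a random variable -/
  measurable_walk : ∀ i, StronglyMeasurable (S i)
  /-- the control takes its values in `[0, q]` almost surely -/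
  control_mem : ∀ i, ∀ᵐ ω ∂μ, u i ω ∈ Set.Icc 0 q
  /-- the control is adapted to the filtration generated by the walk -/
  control_adapted : StronglyAdapted (Filtration.natural S measurable_walk) u
  /-- the walk starts at the origin -/
  start : ∀ᵐ ω ∂μ, S 0 ω = 0
  /-- given the past, the walk stays put with probability `u i` -/
  stay : ∀ i, μ⟦{ω | S (i + 1) ω = S i ω} | Filtration.natural S measurable_walk i⟧
    =ᵐ[μ] u i
  /-- given the past, the walk steps up with probability `(1 - u i) / 2` -/
  step_up : ∀ i, μ⟦{ω | S (i + 1) ω = S i ω + 1} | Filtration.natural S measurable_walk i⟧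
    =ᵐ[μ] fun ω => (1 - u i ω) / 2
  /-- given the past, the walk steps down with probability `(1 - u i) / 2` -/
  step_down : ∀ i, μ⟦{ω | S (i + 1) ω = S i ω - 1} | Filtration.natural S measurable_walk i⟧
    =ᵐ[μ] fun ω => (1 - u i ω) / 2

/-- The set of all values `P(S_n^u = 0)`, where `u` ranges over the `q`-admissible controls.
The choice of the probability space is immaterial: only the law of the walk matters. -/
def returnProbabilities (q : ℝ) (n : ℕ) : Set ℝ :=
  {p | ∃ (Ω : Type) (_ : MeasurableSpace Ω) (μ : Measure Ω) (_ : IsProbabilityMeasure μ)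
      (u : ℕ → Ω → ℝ) (S : ℕ → Ω → ℤ),
      IsControlledWalk μ q u S ∧ p = μ.real {ω | S n ω = 0}}

/-- `sup_{u ∈ U_q} P(S_n^u = 0)`; the supremum is taken over a set of numbers in `[0, 1]`. -/
noncomputable def supReturnProbability (q : ℝ) (n : ℕ) : ℝ :=
  sSup (returnProbabilities q n)

/-! The expected payoff of one step is affine in the control, so only the control values `0` and `q`
matter, and the supremum is the dynamic programming value `valueFn q n 0`
(`supReturnProbability_eq_valueFn`). Since `bestStep` is monotone, comparison with discrete super-
and subsolutions of its recursion bounds this value.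

With `T` the time left, take the ansatz `T ^ (-σ) * f (x / √T)`. In the diffusive limit with
diffusivity `a` it is a subsolution when `2σ f + y f' + a f'' ≥ 0` and a supersolution under the
reverse inequality. The choice is between `a = 1` and `a = 1 - q`: a supersolution must satisfy its
inequality for both, a subsolution only for one of them at each point.

Upper bound: `f = exp (-y² / 4)`, wider than the heat kernel, is a supersolution for `σ ≤ (1 - q) /
4`; the exponent `(1 - q) / 8` leaves room for the lattice error (`bestStep_gaussianSuper_le`).

Lower bound: a strict subsolution profile, truncated at zero, survives discretisation for large `T`
by compactness (`IsSubProfile.exists_lt_valueFn`). Two profiles are used. The heat kernel `exp (-y²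
/ 2)` solves the equation for `σ = 1 / 2`, `a = 1`, and gains from `a = 1 - q` where it is concave;
a small perturbation spreads this gain and lowers `σ` below `1 / 2` (`isSubProfile_gaussian`). For
small `p = 1 - q`, the profile `-log (2 (p + y²))` is convex enough away from the origin to beat the
drift `y f'` at full diffusivity; near the origin slow diffusion costs only `O(1)` while `f` has
size `log (1 / p)`, so `σ` of order `1 / log (1 / p)` suffices (`isSubProfile_log`). -/

/-! ### The value function -/

/-- One step of the dynamic programming recursion. -/
noncomputable def bestStep (q : ℝ) (v : ℤ → ℝ) (x : ℤ) : ℝ :=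
  max ((v (x + 1) + v (x - 1)) / 2) (q * v x + (1 - q) * ((v (x + 1) + v (x - 1)) / 2))

/-- The value function: the best probability of being at the origin after `n` steps. -/
noncomputable def valueFn (q : ℝ) : ℕ → ℤ → ℝ
  | 0 => fun x => if x = 0 then 1 else 0
  | n + 1 => bestStep q (valueFn q n)

theorem bestStep_mono {q : ℝ} (hq : q ∈ Set.Ioo (0 : ℝ) 1) {v w : ℤ → ℝ} (h : ∀ x, v x ≤ w x)
    (x : ℤ) : bestStep q v x ≤ bestStep q w x := by
  have h1 : (v (x + 1) + v (x - 1)) / 2 ≤ (w (x + 1) + w (x - 1)) / 2 := by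
    linarith [h (x + 1), h (x - 1)]
  exact max_le_max h1 (add_le_add (mul_le_mul_of_nonneg_left (h x) hq.1.le)
    (mul_le_mul_of_nonneg_left h1 (sub_nonneg.2 hq.2.le)))

theorem valueFn_mem_Icc {q : ℝ} (hq : q ∈ Set.Ioo (0 : ℝ) 1) (n : ℕ) (x : ℤ) :
    valueFn q n x ∈ Set.Icc (0 : ℝ) 1 := by
  induction n generalizing x with
  | zero => simp only [valueFn]; split_ifs <;> simp
  | succ n ih =>
    have h1 := ih (x + 1)
    have h2 := ih (x - 1)
    have h3 := ih x
    refine ⟨le_trans ?_ (le_max_left _ _), max_le ?_ ?_⟩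
    · linarith [h1.1, h2.1]
    · linarith [h1.2, h2.2]
    · nlinarith [h1.2, h2.2, h3.2, hq.1, hq.2]

theorem abs_valueFn_le_one {q : ℝ} (hq : q ∈ Set.Ioo (0 : ℝ) 1) (n : ℕ) (x : ℤ) :
    |valueFn q n x| ≤ 1 :=
  abs_le.2 ⟨by linarith [(valueFn_mem_Icc hq n x).1], (valueFn_mem_Icc hq n x).2⟩

/-! ### No controlled walk beats the value function -/

namespace IsControlledWalk

variable {Ω : Type*} [MeasurableSpace Ω] {μ : Measure Ω} {q : ℝ} {u : ℕ → Ω → ℝ} {S : ℕ → Ω → ℤ}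

theorem measurable (h : IsControlledWalk μ q u S) (i : ℕ) : Measurable (S i) :=
  (h.measurable_walk i).measurable

theorem stronglyMeasurable_comp (h : IsControlledWalk μ q u S) (i : ℕ) (φ : ℤ → ℝ) :
    StronglyMeasurable[Filtration.natural S h.measurable_walk i] fun ω => φ (S i ω) :=
  (measurable_of_countable φ).stronglyMeasurable.comp_measurable
    (Filtration.stronglyAdapted_natural h.measurable_walk i).measurable

theorem integrable_comp [IsProbabilityMeasure μ] (h : IsControlledWalk μ q u S) (i : ℕ)
    {φ : ℤ → ℝ} (hφ : ∀ x, |φ x| ≤ 1) : Integrable (fun ω => φ (S i ω)) μ :=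
  .of_bound ((measurable_of_countable φ).comp (h.measurable i)).aestronglyMeasurable 1
    (ae_of_all _ fun _ => hφ _)

/-- Pulling the known factor out of the conditional expectation; this is how each of the three
transition laws enters an integral. -/
theorem integral_mul_indicator [IsProbabilityMeasure μ] (h : IsControlledWalk μ q u S) (i : ℕ)
    {φ : ℤ → ℝ} (hφ : ∀ x, |φ x| ≤ 1) {s : Set Ω} (hs : MeasurableSet s) {g : Ω → ℝ}
    (hg : μ⟦s | Filtration.natural S h.measurable_walk i⟧ =ᵐ[μ] g) :
    ∫ ω, φ (S i ω) * s.indicator (fun _ => (1 : ℝ)) ω ∂μ = ∫ ω, φ (S i ω) * g ω ∂μ := by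
  have hle := (Filtration.natural S h.measurable_walk).le i
  have hint : Integrable (s.indicator fun _ => (1 : ℝ)) μ := (integrable_const _).indicator hs
  have hint' : Integrable ((fun ω => φ (S i ω)) * s.indicator fun _ => (1 : ℝ)) μ :=
    hint.bdd_mul (h.integrable_comp i hφ).aestronglyMeasurable (ae_of_all _ fun ω => hφ _)
  have key := condExp_mul_of_stronglyMeasurable_left (h.stronglyMeasurable_comp i φ) hint' hint
  have := integral_condExp hle (f := (fun ω => φ (S i ω)) * s.indicator fun _ => (1 : ℝ)) (μ := μ)
  simp only [Pi.mul_apply] at this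
  rw [← this]
  refine integral_congr_ae ?_
  filter_upwards [key, hg] with ω h1 h2
  rw [h1, Pi.mul_apply, h2]

theorem integral_add_add {f g h : Ω → ℝ} (hf : Integrable f μ) (hg : Integrable g μ)
    (hh : Integrable h μ) :
    ∫ ω, (f ω + (g ω + h ω)) ∂μ = ∫ ω, f ω ∂μ + (∫ ω, g ω ∂μ + ∫ ω, h ω ∂μ) := by
  rw [← integral_add hg hh]
  exact integral_add hf (hg.add hh)

/-- Almost surely every increment is `0`, `1` or `-1`. -/
theorem ae_increment [IsProbabilityMeasure μ] (h : IsControlledWalk μ q u S) (i : ℕ) :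
    ∀ᵐ ω ∂μ, S (i + 1) ω = S i ω ∨ S (i + 1) ω = S i ω + 1 ∨ S (i + 1) ω = S i ω - 1 := by
  have hm0 : MeasurableSet {ω | S (i + 1) ω = S i ω} :=
    measurableSet_eq_fun (h.measurable _) (h.measurable _)
  have hm1 : MeasurableSet {ω | S (i + 1) ω = S i ω + 1} :=
    measurableSet_eq_fun (h.measurable _) ((h.measurable _).add_const 1)
  have hm2 : MeasurableSet {ω | S (i + 1) ω = S i ω - 1} :=
    measurableSet_eq_fun (h.measurable _) ((h.measurable _).sub_const 1)
  have hu : Integrable (u i) μ := integrable_condExp.congr (h.stay i)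
  have e0 := h.integral_mul_indicator i (φ := fun _ => 1) (by simp) hm0 (h.stay i)
  have e1 := h.integral_mul_indicator i (φ := fun _ => 1) (by simp) hm1 (h.step_up i)
  have e2 := h.integral_mul_indicator i (φ := fun _ => 1) (by simp) hm2 (h.step_down i)
  simp only [one_mul] at e0 e1 e2
  have hi : ∀ s : Set Ω, MeasurableSet s → Integrable (s.indicator fun _ => (1 : ℝ)) μ :=
    fun s hs => (integrable_const _).indicator hs
  have hsum : ∫ ω, ({ω | S (i + 1) ω = S i ω}.indicator (fun _ => (1 : ℝ)) ω +
      ({ω | S (i + 1) ω = S i ω + 1}.indicator (fun _ => (1 : ℝ)) ω +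
       {ω | S (i + 1) ω = S i ω - 1}.indicator (fun _ => (1 : ℝ)) ω)) ∂μ = 1 := by
    rw [integral_add_add (hi _ hm0) (hi _ hm1) (hi _ hm2), e0, e1, e2]
    have hu2 : Integrable (fun ω => (1 - u i ω) / 2) μ := ((integrable_const 1).sub hu).div_const 2
    rw [← integral_add_add hu hu2 hu2]
    ring_nf
    simp
  have hle : ∀ ω, {ω | S (i + 1) ω = S i ω}.indicator (fun _ => (1 : ℝ)) ω +
      ({ω | S (i + 1) ω = S i ω + 1}.indicator (fun _ => (1 : ℝ)) ω +
       {ω | S (i + 1) ω = S i ω - 1}.indicator (fun _ => (1 : ℝ)) ω) ≤ 1 := by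
    intro ω
    simp only [Set.indicator_apply, Set.mem_ofPred_eq]
    split_ifs <;> first | omega | norm_num
  -- The events are disjoint, so the sum of indicators is at most `1`; having mean `1`, it equals
  -- `1` almost surely.
  have hz : ∫ ω, (1 - ({ω | S (i + 1) ω = S i ω}.indicator (fun _ => (1 : ℝ)) ω +
      ({ω | S (i + 1) ω = S i ω + 1}.indicator (fun _ => (1 : ℝ)) ω +
       {ω | S (i + 1) ω = S i ω - 1}.indicator (fun _ => (1 : ℝ)) ω))) ∂μ = 0 := by
    refine (integral_sub (integrable_const _)
      ((hi _ hm0).add ((hi _ hm1).add (hi _ hm2)))).trans ?_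
    simp only [Pi.add_apply]
    rw [hsum]
    simp
  rw [integral_eq_zero_iff_of_nonneg (fun ω => sub_nonneg.2 (hle ω))
    ((integrable_const _).sub ((hi _ hm0).add ((hi _ hm1).add (hi _ hm2))))] at hz
  filter_upwards [hz] with ω hω
  by_contra hcon
  simp only [not_or] at hcon
  simp [hcon] at hω

theorem integral_succ [IsProbabilityMeasure μ] (h : IsControlledWalk μ q u S) (i : ℕ)
    {φ : ℤ → ℝ} (hφ : ∀ x, |φ x| ≤ 1) :
    ∫ ω, φ (S (i + 1) ω) ∂μ = ∫ ω, (u i ω * φ (S i ω) +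
      (1 - u i ω) * ((φ (S i ω + 1) + φ (S i ω - 1)) / 2)) ∂μ := by
  have hm0 : MeasurableSet {ω | S (i + 1) ω = S i ω} :=
    measurableSet_eq_fun (h.measurable _) (h.measurable _)
  have hm1 : MeasurableSet {ω | S (i + 1) ω = S i ω + 1} :=
    measurableSet_eq_fun (h.measurable _) ((h.measurable _).add_const 1)
  have hm2 : MeasurableSet {ω | S (i + 1) ω = S i ω - 1} :=
    measurableSet_eq_fun (h.measurable _) ((h.measurable _).sub_const 1)
  have hu : Integrable (u i) μ := integrable_condExp.congr (h.stay i)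
  have hu2 : Integrable (fun ω => (1 - u i ω) / 2) μ := ((integrable_const 1).sub hu).div_const 2
  have e0 := h.integral_mul_indicator i hφ hm0 (h.stay i)
  have e1 := h.integral_mul_indicator i (φ := fun x => φ (x + 1)) (fun _ => hφ _) hm1 (h.step_up i)
  have e2 := h.integral_mul_indicator i (φ := fun x => φ (x - 1)) (fun _ => hφ _) hm2
    (h.step_down i)
  have hb : ∀ {φ : ℤ → ℝ} {g : Ω → ℝ}, (∀ x, |φ x| ≤ 1) → Integrable g μ →
      Integrable (fun ω => φ (S i ω) * g ω) μ := fun hφ hg =>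
    hg.bdd_mul (h.integrable_comp i hφ).aestronglyMeasurable (ae_of_all _ fun ω => hφ _)
  have hi : ∀ s : Set Ω, MeasurableSet s → Integrable (s.indicator fun _ => (1 : ℝ)) μ :=
    fun s hs => (integrable_const _).indicator hs
  have i0 := hb hφ (hi _ hm0)
  have i1 := hb (φ := fun x => φ (x + 1)) (fun _ => hφ _) (hi _ hm1)
  have i2 := hb (φ := fun x => φ (x - 1)) (fun _ => hφ _) (hi _ hm2)
  have j0 := hb hφ hu
  have j1 := hb (φ := fun x => φ (x + 1)) (fun _ => hφ _) hu2
  have j2 := hb (φ := fun x => φ (x - 1)) (fun _ => hφ _) hu2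
  have hsplit : ∫ ω, φ (S (i + 1) ω) ∂μ =
      ∫ ω, (φ (S i ω) * {ω | S (i + 1) ω = S i ω}.indicator (fun _ => (1 : ℝ)) ω +
      (φ (S i ω + 1) * {ω | S (i + 1) ω = S i ω + 1}.indicator (fun _ => (1 : ℝ)) ω +
       φ (S i ω - 1) * {ω | S (i + 1) ω = S i ω - 1}.indicator (fun _ => (1 : ℝ)) ω)) ∂μ := by
    refine integral_congr_ae ?_
    filter_upwards [h.ae_increment i] with ω hω
    simp only [Set.indicator_apply, Set.mem_ofPred_eq]
    rcases hω with hω | hω | hω <;> simp only [hω] <;> simp <;> intro <;> omega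
  rw [hsplit, integral_add_add i0 i1 i2, e0, e1, e2, ← integral_add_add j0 j1 j2]
  congr 1 with ω
  ring

/-- The value function decreases in mean along every controlled walk. -/
theorem integral_valueFn_succ_le [IsProbabilityMeasure μ] (h : IsControlledWalk μ q u S)
    (hq : q ∈ Set.Ioo (0 : ℝ) 1) (i m : ℕ) :
    ∫ ω, valueFn q m (S (i + 1) ω) ∂μ ≤ ∫ ω, valueFn q (m + 1) (S i ω) ∂μ := by
  rw [h.integral_succ i (abs_valueFn_le_one hq m)]
  refine integral_mono_of_nonneg ?_ (h.integrable_comp i (abs_valueFn_le_one hq (m + 1))) ?_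
  · filter_upwards [h.control_mem i] with ω hω
    have h1 := (valueFn_mem_Icc hq m (S i ω + 1)).1
    have h2 := (valueFn_mem_Icc hq m (S i ω - 1)).1
    have h3 := (valueFn_mem_Icc hq m (S i ω)).1
    have : 0 ≤ 1 - u i ω := by linarith [hω.2, hq.2]
    exact add_nonneg (mul_nonneg hω.1 h3) (mul_nonneg this (by linarith))
  · filter_upwards [h.control_mem i] with ω hω
    simp only [valueFn, bestStep]
    -- An affine function of `u` on `[0, q]` is at most its value at an endpoint; comparing staying
    -- with moving decides which.
    rcases le_total (valueFn q m (S i ω))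
      ((valueFn q m (S i ω + 1) + valueFn q m (S i ω - 1)) / 2) with hc | hc
    · refine le_trans ?_ (le_max_left _ _)
      nlinarith [hω.1]
    · refine le_trans ?_ (le_max_right _ _)
      nlinarith [hω.2]

theorem integral_valueFn_zero [IsProbabilityMeasure μ] (h : IsControlledWalk μ q u S) (n : ℕ) :
    ∫ ω, valueFn q 0 (S n ω) ∂μ = μ.real {ω | S n ω = 0} := by
  have hm : MeasurableSet {ω | S n ω = 0} :=
    measurableSet_eq_fun (h.measurable n) measurable_const
  rw [← integral_indicator_one hm]
  congr 1 with ω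
  simp [valueFn, Set.indicator_apply]

theorem integral_valueFn_start [IsProbabilityMeasure μ] (h : IsControlledWalk μ q u S) (n : ℕ) :
    ∫ ω, valueFn q n (S 0 ω) ∂μ = valueFn q n 0 := by
  have : ∫ ω, valueFn q n (S 0 ω) ∂μ = ∫ _, valueFn q n 0 ∂μ := by
    refine integral_congr_ae ?_
    filter_upwards [h.start] with ω hω
    rw [hω]
  simp [this]

/-- Trading an elapsed step for a step left never lowers the mean of the value function; `n` trades
lead from the payoff back to the start. -/
theorem real_le_valueFn [IsProbabilityMeasure μ] (h : IsControlledWalk μ q u S)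
    (hq : q ∈ Set.Ioo (0 : ℝ) 1) (n : ℕ) : μ.real {ω | S n ω = 0} ≤ valueFn q n 0 := by
  rw [← h.integral_valueFn_zero, ← h.integral_valueFn_start]
  have : ∀ k m, ∫ ω, valueFn q m (S k ω) ∂μ ≤ ∫ ω, valueFn q (m + k) (S 0 ω) ∂μ := by
    intro k
    induction k with
    | zero => intro m; exact le_rfl
    | succ k ih =>
      intro m
      refine (h.integral_valueFn_succ_le hq k m).trans ((ih (m + 1)).trans_eq ?_)
      rw [add_right_comm, add_assoc]
  simpa using this n 0

end IsControlledWalk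

/-! ### Realising Markov policies that use only the controls `0` and `q` -/

/-- The law of a symmetric nearest neighbour step that is `0` with probability `r`. -/
noncomputable def stepMeasure (r : ℝ) : Measure ℤ :=
  ENNReal.ofReal r • Measure.dirac 0 +
    ENNReal.ofReal ((1 - r) / 2) • (Measure.dirac 1 + Measure.dirac (-1))

theorem stepMeasure_real {r : ℝ} (hr : r ∈ Set.Icc (0 : ℝ) 1) (s : Set ℤ) :
    (stepMeasure r).real s = r * s.indicator 1 0 +
      (1 - r) / 2 * (s.indicator 1 1 + s.indicator 1 (-1)) := by
  have h1 : 0 ≤ (1 - r) / 2 := by linarith [hr.2]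
  have hf : ∀ a : ℤ, s.indicator (1 : ℤ → ENNReal) a ≠ ⊤ := fun a => by
    by_cases h : a ∈ s <;> simp [h]
  have hi : ∀ a : ℤ, (s.indicator (1 : ℤ → ENNReal) a).toReal = s.indicator (1 : ℤ → ℝ) a :=
    fun a => by by_cases h : a ∈ s <;> simp [h]
  rw [measureReal_def, stepMeasure]
  simp only [Measure.coe_add, Measure.coe_smul, Pi.add_apply, Pi.smul_apply, smul_eq_mul,
    Measure.dirac_apply]
  rw [ENNReal.toReal_add (ENNReal.mul_ne_top ENNReal.ofReal_ne_top (hf _))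
    (ENNReal.mul_ne_top ENNReal.ofReal_ne_top (ENNReal.add_ne_top.2 ⟨hf _, hf _⟩)),
    ENNReal.toReal_mul, ENNReal.toReal_mul, ENNReal.toReal_add (hf _) (hf _),
    ENNReal.toReal_ofReal hr.1, ENNReal.toReal_ofReal h1, hi, hi, hi]

theorem isProbabilityMeasure_stepMeasure {r : ℝ} (hr : r ∈ Set.Icc (0 : ℝ) 1) :
    IsProbabilityMeasure (stepMeasure r) := by
  have h := stepMeasure_real hr Set.univ
  simp only [Set.indicator_univ, Pi.one_apply] at h
  refine ⟨?_⟩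
  have h' : (stepMeasure r).real Set.univ = 1 := by rw [h]; ring
  rw [measureReal_def] at h'
  exact (ENNReal.toReal_eq_one_iff _).1 h'

open scoped Classical in
/-- The walk driven by the noise `ω`, which uses the first coordinate of the noise
when it sits in `A i` at time `i`, and the second coordinate otherwise. -/
noncomputable def drivenWalk (A : ℕ → Set ℤ) : ℕ → (ℕ → ℤ × ℤ) → ℤ
  | 0, _ => 0
  | i + 1, ω => drivenWalk A i ω + if drivenWalk A i ω ∈ A i then (ω i).1 else (ω i).2

/-- The law of the noise: lazy steps in the first coordinate, simple steps in the second. -/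
noncomputable def noiseMeasure (q : ℝ) : Measure (ℕ → ℤ × ℤ) :=
  Measure.infinitePi fun _ => (stepMeasure q).prod (stepMeasure 0)

/-- The events determined by the noise before time `i`. -/
abbrev noisePast (i : ℕ) : MeasurableSpace (ℕ → ℤ × ℤ) :=
  ⨆ j ∈ Set.Iio i, MeasurableSpace.comap (fun ω => ω j) inferInstance

theorem noisePast_mono : Monotone noisePast := fun _ _ h =>
  biSup_mono fun _ hj => lt_of_lt_of_le hj h

theorem noisePast_le (i : ℕ) : noisePast i ≤ MeasurableSpace.pi :=
  iSup₂_le fun j _ => (measurable_pi_apply j).comap_le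

theorem measurable_drivenWalk (A : ℕ → Set ℤ) (i : ℕ) :
    Measurable[noisePast i] (drivenWalk A i) := by
  induction i with
  | zero => exact measurable_const
  | succ i ih =>
    have h1 : Measurable[noisePast (i + 1)] (drivenWalk A i) :=
      ih.mono (noisePast_mono i.le_succ) le_rfl
    have h2 : Measurable[noisePast (i + 1)] fun ω : ℕ → ℤ × ℤ => ω i := by
      rw [measurable_iff_comap_le]
      exact le_biSup (fun j => MeasurableSpace.comap (fun ω : ℕ → ℤ × ℤ => ω j) inferInstance)
        (Set.mem_Iio.2 i.lt_succ_self)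
    exact h1.add (Measurable.ite (h1 (MeasurableSet.of_discrete (s := A i))) h2.fst h2.snd)

theorem stronglyMeasurable_drivenWalk (A : ℕ → Set ℤ) (i : ℕ) :
    StronglyMeasurable (drivenWalk A i) :=
  ((measurable_drivenWalk A i).mono (noisePast_le i) le_rfl).stronglyMeasurable

/-- The position at time `i` uses only the noise coordinates before `i`, so the noise at time `i` is
independent of the walk's own filtration. -/
theorem natural_le_noisePast (A : ℕ → Set ℤ) (i : ℕ) :
    Filtration.natural (drivenWalk A) (stronglyMeasurable_drivenWalk A) i ≤ noisePast i :=
  iSup₂_le fun j hj =>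
    ((measurable_drivenWalk A j).mono (noisePast_mono hj) le_rfl).comap_le

theorem isProbabilityMeasure_noiseMeasure {q : ℝ} (hq : q ∈ Set.Ioo (0 : ℝ) 1) :
    IsProbabilityMeasure (noiseMeasure q) := by
  have := isProbabilityMeasure_stepMeasure ⟨hq.1.le, hq.2.le⟩
  have := isProbabilityMeasure_stepMeasure (r := 0) ⟨le_rfl, zero_le_one⟩
  unfold noiseMeasure
  infer_instance

theorem indep_noise_noisePast {q : ℝ} (hq : q ∈ Set.Ioo (0 : ℝ) 1) (i : ℕ) :
    Indep (MeasurableSpace.comap (fun ω : ℕ → ℤ × ℤ => ω i) inferInstance) (noisePast i)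
      (noiseMeasure q) := by
  have := isProbabilityMeasure_stepMeasure ⟨hq.1.le, hq.2.le⟩
  have := isProbabilityMeasure_stepMeasure (r := 0) ⟨le_rfl, zero_le_one⟩
  have h : iIndepFun (fun i (ω : ℕ → ℤ × ℤ) => ω i) (noiseMeasure q) :=
    iIndepFun_infinitePi (P := fun _ : ℕ => (stepMeasure q).prod (stepMeasure 0))
      (X := fun _ x => x) fun _ => measurable_id
  have := indep_iSup_of_disjoint (fun j => (measurable_pi_apply j).comap_le) h.iIndep
    (S := {i}) (T := Set.Iio i) (by simp)
  simpa [noisePast] using this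

/-- The noise at time `i` is independent of the past of the walk. -/
theorem condExp_noise {q : ℝ} (hq : q ∈ Set.Ioo (0 : ℝ) 1) (A : ℕ → Set ℤ) (i : ℕ)
    (s : Set (ℤ × ℤ)) :
    (noiseMeasure q)⟦{ω | ω i ∈ s} |
        Filtration.natural (drivenWalk A) (stronglyMeasurable_drivenWalk A) i⟧
      =ᵐ[noiseMeasure q] fun _ => ((stepMeasure q).prod (stepMeasure 0)).real s := by
  have := isProbabilityMeasure_stepMeasure ⟨hq.1.le, hq.2.le⟩
  have := isProbabilityMeasure_stepMeasure (r := 0) ⟨le_rfl, zero_le_one⟩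
  have := isProbabilityMeasure_noiseMeasure hq
  have hs : MeasurableSet s := .of_discrete
  have hm : MeasurableSet {ω : ℕ → ℤ × ℤ | ω i ∈ s} := measurable_pi_apply i hs
  have := condExp_indep_eq (μ := noiseMeasure q) (f := {ω | ω i ∈ s}.indicator fun _ => (1 : ℝ))
    (measurable_pi_apply i).comap_le
    ((Filtration.natural (drivenWalk A) (stronglyMeasurable_drivenWalk A)).le i)
    (stronglyMeasurable_const.indicator ⟨s, hs, rfl⟩)
    (indep_of_indep_of_le_right (indep_noise_noisePast hq i) (natural_le_noisePast A i))
  refine this.trans (ae_of_all _ fun _ => ?_)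
  dsimp only
  rw [integral_indicator_const _ hm, smul_eq_mul, mul_one]
  exact (measurePreserving_eval_infinitePi
    (fun _ : ℕ => (stepMeasure q).prod (stepMeasure 0)) i).measureReal_preimage hs.nullMeasurableSet

open scoped Classical in
theorem condExp_drivenWalk_step {q : ℝ} (hq : q ∈ Set.Ioo (0 : ℝ) 1) (A : ℕ → Set ℤ)
    (i : ℕ) (k : ℤ) :
    (noiseMeasure q)⟦{ω | drivenWalk A (i + 1) ω = drivenWalk A i ω + k} |
        Filtration.natural (drivenWalk A) (stronglyMeasurable_drivenWalk A) i⟧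
      =ᵐ[noiseMeasure q] fun ω =>
        if drivenWalk A i ω ∈ A i then (stepMeasure q).real {k} else (stepMeasure 0).real {k} := by
  have := isProbabilityMeasure_stepMeasure ⟨hq.1.le, hq.2.le⟩
  have := isProbabilityMeasure_stepMeasure (r := 0) ⟨le_rfl, zero_le_one⟩
  have := isProbabilityMeasure_noiseMeasure hq
  set F := Filtration.natural (drivenWalk A) (stronglyMeasurable_drivenWalk A) with hF
  have hmeas : ∀ g : ℤ → ℝ, StronglyMeasurable[F i] fun ω => g (drivenWalk A i ω) := fun g =>
    (measurable_of_countable g).stronglyMeasurable.comp_measurable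
      (Filtration.stronglyAdapted_natural (stronglyMeasurable_drivenWalk A) i).measurable
  have hint : ∀ s : Set (ℤ × ℤ),
      Integrable ({ω : ℕ → ℤ × ℤ | ω i ∈ s}.indicator fun _ => (1 : ℝ)) (noiseMeasure q) :=
    fun s => (integrable_const _).indicator (measurable_pi_apply i (.of_discrete (s := s)))
  have key : ∀ (g : ℤ → ℝ) (s : Set (ℤ × ℤ)), (∀ x, |g x| ≤ 1) →
      Integrable ((fun ω => g (drivenWalk A i ω)) *
        {ω : ℕ → ℤ × ℤ | ω i ∈ s}.indicator fun _ => (1 : ℝ)) (noiseMeasure q) ∧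
      (noiseMeasure q)[(fun ω => g (drivenWalk A i ω)) *
        {ω : ℕ → ℤ × ℤ | ω i ∈ s}.indicator (fun _ => (1 : ℝ)) | F i] =ᵐ[noiseMeasure q]
        fun ω => g (drivenWalk A i ω) * ((stepMeasure q).prod (stepMeasure 0)).real s := by
    intro g s hg
    have hb := (hint s).bdd_mul ((hmeas g).mono (F.le i)).aestronglyMeasurable
      (ae_of_all _ fun ω => hg (drivenWalk A i ω))
    refine ⟨hb, (condExp_mul_of_stronglyMeasurable_left (hmeas g) hb (hint s)).trans ?_⟩
    filter_upwards [condExp_noise hq A i s] with ω hω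
    rw [Pi.mul_apply, hω]
  obtain ⟨i1, k1⟩ := key ((A i).indicator 1) {p | p.1 = k} fun x => by
    by_cases h : x ∈ A i <;> simp [h]
  obtain ⟨i2, k2⟩ := key ((A i)ᶜ.indicator 1) {p | p.2 = k} fun x => by
    by_cases h : x ∈ A i <;> simp [h]
  have e1 : ((stepMeasure q).prod (stepMeasure 0)).real {p | p.1 = k} =
      (stepMeasure q).real {k} := by
    have : {p : ℤ × ℤ | p.1 = k} = {k} ×ˢ Set.univ := by ext; simp
    rw [this, measureReal_prod_prod]; simp
  have e2 : ((stepMeasure q).prod (stepMeasure 0)).real {p | p.2 = k} =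
      (stepMeasure 0).real {k} := by
    have : {p : ℤ × ℤ | p.2 = k} = Set.univ ×ˢ {k} := by ext; simp
    rw [this, measureReal_prod_prod]; simp
  -- Splitting on whether the walk sits in `A i` writes the event as factors known at time `i` times
  -- independent noise events.
  have hdec : {ω | drivenWalk A (i + 1) ω = drivenWalk A i ω + k}.indicator (fun _ => (1 : ℝ)) =
      (fun ω => (A i).indicator (1 : ℤ → ℝ) (drivenWalk A i ω)) *
        {ω : ℕ → ℤ × ℤ | ω i ∈ {p : ℤ × ℤ | p.1 = k}}.indicator (fun _ => (1 : ℝ)) +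
      (fun ω => (A i)ᶜ.indicator (1 : ℤ → ℝ) (drivenWalk A i ω)) *
        {ω : ℕ → ℤ × ℤ | ω i ∈ {p : ℤ × ℤ | p.2 = k}}.indicator (fun _ => (1 : ℝ)) := by
    ext ω
    by_cases h : drivenWalk A i ω ∈ A i <;> simp [drivenWalk, Set.indicator_apply, h]
  rw [hdec]
  filter_upwards [condExp_add i1 i2 (F i), k1, k2] with ω h0 h1 h2
  rw [h0, Pi.add_apply, h1, h2, e1, e2]
  by_cases h : drivenWalk A i ω ∈ A i <;> simp [h]

open scoped Classical in
/-- Every time-dependent Markov policy is realised by a controlled walk. -/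
theorem isControlledWalk_drivenWalk {q : ℝ} (hq : q ∈ Set.Ioo (0 : ℝ) 1) (A : ℕ → Set ℤ) :
    IsControlledWalk (noiseMeasure q) q (fun i ω => if drivenWalk A i ω ∈ A i then q else 0)
      (drivenWalk A) where
  measurable_walk := stronglyMeasurable_drivenWalk A
  control_mem i := ae_of_all _ fun ω => by
    split_ifs
    · exact ⟨hq.1.le, le_rfl⟩
    · exact ⟨le_rfl, hq.1.le⟩
  control_adapted i :=
    (measurable_of_countable fun x : ℤ => if x ∈ A i then q else
      0).stronglyMeasurable.comp_measurable
      (Filtration.stronglyAdapted_natural (stronglyMeasurable_drivenWalk A) i).measurable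
  start := ae_of_all _ fun _ => rfl
  stay i := by
    have h := condExp_drivenWalk_step hq A i 0
    simp only [add_zero] at h
    refine h.trans (ae_of_all _ fun ω => ?_)
    rw [stepMeasure_real ⟨hq.1.le, hq.2.le⟩, stepMeasure_real ⟨le_rfl, zero_le_one⟩]
    by_cases h : drivenWalk A i ω ∈ A i <;> simp [h]
  step_up i := by
    refine (condExp_drivenWalk_step hq A i 1).trans (ae_of_all _ fun ω => ?_)
    dsimp only
    rw [stepMeasure_real ⟨hq.1.le, hq.2.le⟩, stepMeasure_real ⟨le_rfl, zero_le_one⟩]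
    by_cases h : drivenWalk A i ω ∈ A i <;> simp [h]
  step_down i := by
    have h := condExp_drivenWalk_step hq A i (-1)
    simp only [← sub_eq_add_neg] at h
    refine h.trans (ae_of_all _ fun ω => ?_)
    rw [stepMeasure_real ⟨hq.1.le, hq.2.le⟩, stepMeasure_real ⟨le_rfl, zero_le_one⟩]
    by_cases h : drivenWalk A i ω ∈ A i <;> simp [h]

/-- The value function is attained. -/
theorem valueFn_mem_returnProbabilities {q : ℝ} (hq : q ∈ Set.Ioo (0 : ℝ) 1) (n : ℕ) :
    valueFn q n 0 ∈ returnProbabilities q n := by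
  classical
  have := isProbabilityMeasure_noiseMeasure hq
  let v := valueFn q
  -- Lazy exactly where staying is at least as good as moving; after step `i` there are `n - i - 1`
  -- steps left. Truncated subtraction matters only for `i ≥ n`, which plays no role.
  let A : ℕ → Set ℤ := fun i =>
    {x | (v (n - i - 1) (x + 1) + v (n - i - 1) (x - 1)) / 2 ≤ v (n - i - 1) x}
  have hw := isControlledWalk_drivenWalk hq A
  refine ⟨_, _, noiseMeasure q, this, _, _, hw, ?_⟩
  rw [← hw.integral_valueFn_zero (q := q), ← hw.integral_valueFn_start]
  have : ∀ k ≤ n, ∫ ω, v (n - k) (drivenWalk A k ω) ∂noiseMeasure q =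
      ∫ ω, v n (drivenWalk A 0 ω) ∂noiseMeasure q := by
    intro k
    induction k with
    | zero => intro _; rfl
    | succ k ih =>
      intro hk
      rw [← ih (by omega), hw.integral_succ k (abs_valueFn_le_one hq _)]
      obtain ⟨m, hm⟩ : ∃ m, n - k = m + 1 := ⟨n - k - 1, by omega⟩
      have hm' : n - (k + 1) = m := by omega
      rw [hm, hm']
      congr 1 with ω
      have hA : drivenWalk A k ω ∈ A k ↔
          (v m (drivenWalk A k ω + 1) + v m (drivenWalk A k ω - 1)) / 2 ≤
            v m (drivenWalk A k ω) := by
        simp only [A, hm, Nat.add_sub_cancel, Set.mem_ofPred_eq]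
      change _ = bestStep q (v m) _
      simp only [bestStep]
      split_ifs with h
      · rw [hA] at h
        refine (max_eq_right ?_).symm
        nlinarith [hq.1]
      · rw [hA] at h
        rw [max_eq_left]
        · simp [v]
        · nlinarith [hq.1]
  have h := this n le_rfl
  rw [Nat.sub_self] at h
  exact h.symm

theorem supReturnProbability_eq_valueFn {q : ℝ} (hq : q ∈ Set.Ioo (0 : ℝ) 1) (n : ℕ) :
    supReturnProbability q n = valueFn q n 0 := by
  have : IsGreatest (returnProbabilities q n) (valueFn q n 0) := by
    refine ⟨valueFn_mem_returnProbabilities hq n, ?_⟩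
    rintro p ⟨Ω, _, μ, _, u, S, h, rfl⟩
    exact h.real_le_valueFn hq n
  exact this.csSup_eq

/-! ### The Gaussian supersolution and the upper bound -/

/-- A discrete supersolution of the dynamic programming recursion. -/
noncomputable def gaussianSuper (σ : ℝ) (t : ℕ) (x : ℤ) : ℝ :=
  ((t : ℝ) + 1) ^ (-σ) * Real.exp (-((x : ℝ) ^ 2 / (4 * (t + 1))))

/-- The average factors as the centred Gaussian times `exp (-1 / (4T)) * cosh (y / (2T))`, and `cosh
s ≤ exp (s² / 2)`. -/
theorem exp_add_exp_le (T y : ℝ) (hT : 0 < T) :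
    (Real.exp (-((y + 1) ^ 2 / (4 * T))) + Real.exp (-((y - 1) ^ 2 / (4 * T)))) / 2 ≤
      Real.exp (-(y ^ 2 / (4 * T))) * Real.exp (-(1 / (4 * T)) + y ^ 2 / (8 * T ^ 2)) := by
  have h := Real.cosh_le_exp_half_sq (y / (2 * T))
  rw [Real.cosh_eq] at h
  have e1 : Real.exp (-((y + 1) ^ 2 / (4 * T))) =
      Real.exp (-(y ^ 2 / (4 * T))) * Real.exp (-(1 / (4 * T))) * Real.exp (-(y / (2 * T))) := by
    rw [← Real.exp_add, ← Real.exp_add]; congr 1; field_simp; ring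
  have e2 : Real.exp (-((y - 1) ^ 2 / (4 * T))) =
      Real.exp (-(y ^ 2 / (4 * T))) * Real.exp (-(1 / (4 * T))) * Real.exp (y / (2 * T)) := by
    rw [← Real.exp_add, ← Real.exp_add]; congr 1; field_simp; ring
  have e3 : (y / (2 * T)) ^ 2 / 2 = y ^ 2 / (8 * T ^ 2) := by field_simp; ring
  rw [e3] at h
  rw [e1, e2, Real.exp_add, ← mul_assoc]
  have hp : 0 < Real.exp (-(y ^ 2 / (4 * T))) * Real.exp (-(1 / (4 * T))) := by positivity
  nlinarith [mul_le_mul_of_nonneg_left h hp.le]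

theorem rpow_neg_succ_ge (σ T : ℝ) (hσ : 0 ≤ σ) (hT : 0 < T) :
    T ^ (-σ) * Real.exp (-(σ / T)) ≤ (T + 1) ^ (-σ) := by
  rw [Real.rpow_def_of_pos hT, Real.rpow_def_of_pos (by linarith), ← Real.exp_add,
    Real.exp_le_exp]
  have h := Real.log_le_sub_one_of_pos (x := (T + 1) / T) (by positivity)
  rw [Real.log_div (by linarith) hT.ne'] at h
  have : (T + 1) / T - 1 = 1 / T := by field_simp; ring
  rw [this] at h
  have : σ / T = σ * (1 / T) := by ring
  nlinarith [mul_le_mul_of_nonneg_left h hσ]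

/-- For `z ≥ 0` laziness only loses. On `[-1/4, 0]` the exponential lies below the line `1 + 7z/8`,
and `1 + w ≤ exp w` concludes. -/
theorem lazy_exp_le {q z w : ℝ} (hq : q ∈ Set.Ioo (0 : ℝ) 1) (hz : -(1 / 4) ≤ z)
    (h1 : z ≤ w) (h2 : 7 / 8 * (1 - q) * z ≤ w) :
    q + (1 - q) * Real.exp z ≤ Real.exp w := by
  rcases le_total 0 z with h | h
  · have : 1 ≤ Real.exp z := Real.one_le_exp h
    nlinarith [Real.exp_le_exp.2 h1, hq.1]
  · have h3 : Real.exp z ≤ 1 + 7 / 8 * z := by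
      have h6 : (1 - z + z ^ 2 / 2) * Real.exp z ≤ 1 := by
        have := Real.quadratic_le_exp_of_nonneg (x := -z) (by linarith)
        have e : Real.exp (-z) * Real.exp z = 1 := by rw [← Real.exp_add]; simp
        nlinarith [Real.exp_pos z]
      have h7 : (1 : ℝ) ≤ (1 + 7 / 8 * z) * (1 - z + z ^ 2 / 2) := by
        have h8 := mul_nonneg (sub_nonneg.2 h) (by linarith : (0 : ℝ) ≤ z + 1 / 4)
        nlinarith [mul_nonneg h8 (sub_nonneg.2 h)]
      have h8 : 0 < 1 - z + z ^ 2 / 2 := by nlinarith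
      by_contra hc
      push Not at hc
      nlinarith
    have h4 := Real.add_one_le_exp w
    nlinarith [mul_le_mul_of_nonneg_left h3 (sub_nonneg.2 hq.2.le)]

theorem bestStep_gaussianSuper_le {q : ℝ} (hq : q ∈ Set.Ioo (0 : ℝ) 1) (t : ℕ) (x : ℤ) :
    bestStep q (gaussianSuper ((1 - q) / 8) t) x ≤ gaussianSuper ((1 - q) / 8) (t + 1) x := by
  obtain ⟨T, hT⟩ : ∃ T : ℝ, T = (t : ℝ) + 1 := ⟨_, rfl⟩
  have hT1 : 1 ≤ T := by rw [hT]; simp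
  have hT0 : 0 < T := by linarith
  obtain ⟨y, hy⟩ : ∃ y : ℝ, y = (x : ℝ) := ⟨_, rfl⟩
  have hσ : 0 ≤ (1 - q) / 8 := by linarith [hq.2]
  simp only [bestStep, gaussianSuper]
  push_cast
  rw [← hT, ← hy]
  -- Averaging multiplies the Gaussian by at most `exp z`; passing from `T` to `T + 1` multiplies it
  -- by at least `exp w`.
  set z := -(1 / (4 * T)) + y ^ 2 / (8 * T ^ 2) with hz
  set w := -((1 - q) / 8 / T) + y ^ 2 / (4 * (T * (T + 1))) with hw
  set G := T ^ (-((1 - q) / 8)) * Real.exp (-(y ^ 2 / (4 * T))) with hG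
  have hG0 : 0 < G := by positivity
  have havg := mul_le_mul_of_nonneg_left (exp_add_exp_le T y hT0)
    (Real.rpow_nonneg hT0.le (-((1 - q) / 8)))
  rw [← mul_assoc, ← hG, ← hz] at havg
  have hnext : G * Real.exp w ≤
      (T + 1) ^ (-((1 - q) / 8)) * Real.exp (-(y ^ 2 / (4 * (T + 1)))) := by
    have h := mul_le_mul_of_nonneg_right (rpow_neg_succ_ge ((1 - q) / 8) T hσ hT0)
      (Real.exp_pos (-(y ^ 2 / (4 * (T + 1))))).le
    refine le_trans (le_of_eq ?_) h
    rw [hG, mul_assoc, mul_assoc, ← Real.exp_add, ← Real.exp_add]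
    congr 2
    rw [hw]; field_simp; ring
  -- This is `T + 1 ≤ 2T`, one reason for the shift `T = t + 1`.
  have hsq : y ^ 2 / (8 * T ^ 2) ≤ y ^ 2 / (4 * (T * (T + 1))) :=
    div_le_div_of_nonneg_left (sq_nonneg y) (by positivity) (by nlinarith)
  have hsq0 : 0 ≤ y ^ 2 / (8 * T ^ 2) := by positivity
  have hi : 0 < 1 / T := by positivity
  have hi1 : 1 / T ≤ 1 := by rw [div_le_one hT0]; exact hT1
  have e1 : 1 / (4 * T) = 1 / 4 * (1 / T) := by field_simp
  have e2 : (1 - q) / 8 / T = (1 - q) / 8 * (1 / T) := by field_simp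
  rw [e1] at hz
  rw [e2] at hw
  have hqz : (1 - q) * (1 / T) ≤ 1 / T := by nlinarith [hq.1]
  have hqz0 : 0 ≤ (1 - q) * (1 / T) := mul_nonneg (by linarith [hq.2]) hi.le
  have hzw : z ≤ w := by rw [hz, hw]; linarith
  have hlazy : q + (1 - q) * Real.exp z ≤ Real.exp w := by
    refine lazy_exp_le hq (by rw [hz]; linarith) hzw ?_
    -- At `y = 0` the claim is `7/8 * 1/4 ≥ 1/8`: the slack in the exponent absorbs the
    -- linearisation.
    rw [hz, hw]
    have : (1 - q) * (y ^ 2 / (8 * T ^ 2)) ≤ y ^ 2 / (8 * T ^ 2) := by nlinarith [hq.1]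
    nlinarith
  have havg' : (T ^ (-((1 - q) / 8)) * Real.exp (-((y + 1) ^ 2 / (4 * T))) +
      T ^ (-((1 - q) / 8)) * Real.exp (-((y - 1) ^ 2 / (4 * T)))) / 2 ≤ G * Real.exp z := by
    linarith
  refine (max_le ?_ ?_).trans hnext
  · exact havg'.trans (mul_le_mul_of_nonneg_left (Real.exp_le_exp.2 hzw) hG0.le)
  · nlinarith [mul_le_mul_of_nonneg_left havg' (sub_nonneg.2 hq.2.le),
      mul_le_mul_of_nonneg_left hlazy hG0.le]

theorem valueFn_le_gaussianSuper {q : ℝ} (hq : q ∈ Set.Ioo (0 : ℝ) 1) (n : ℕ) (x : ℤ) :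
    valueFn q n x ≤ gaussianSuper ((1 - q) / 8) n x := by
  induction n generalizing x with
  | zero =>
    by_cases h : x = 0
    · simp [valueFn, gaussianSuper, h]
    · simp only [valueFn, gaussianSuper, h, if_false]
      positivity
  | succ n ih => exact (bestStep_mono hq ih x).trans (bestStep_gaussianSuper_le hq n x)

/-- The factor `2` only makes the inequality strict. -/
theorem valueFn_lt_rpow {q : ℝ} (hq : q ∈ Set.Ioo (0 : ℝ) 1) {n : ℕ} (hn : 1 ≤ n) :
    valueFn q n 0 < 2 * (n : ℝ) ^ (-((1 - q) / 8)) := by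
  have h := valueFn_le_gaussianSuper hq n 0
  simp only [gaussianSuper, Int.cast_zero, ne_eq, OfNat.ofNat_ne_zero, not_false_eq_true, zero_pow,
    zero_div, neg_zero, Real.exp_zero, mul_one] at h
  have hn0 : (0 : ℝ) < n := by exact_mod_cast hn
  have h2 := Real.rpow_le_rpow_of_nonpos hn0 (by linarith : (n : ℝ) ≤ n + 1)
    (by linarith [hq.2] : -((1 - q) / 8) ≤ 0)
  have h3 : 0 < (n : ℝ) ^ (-((1 - q) / 8)) := by positivity
  linarith

/-! ### Discretising the self-similar differential inequality -/

/-- The mean value theorem applied to `f (z + t) + f (z - t) - m t²` on `[0, e]`, then to `f1`,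
replaces a Taylor remainder. -/
theorem second_difference_ge {f f1 f2 : ℝ → ℝ} (hf : ∀ y, HasDerivAt f (f1 y) y)
    (hf1 : ∀ y, HasDerivAt f1 (f2 y) y) {z e m : ℝ} (he : 0 < e)
    (hm : ∀ ξ ∈ Set.Icc (z - e) (z + e), m ≤ f2 ξ) :
    e ^ 2 * m ≤ f (z + e) + f (z - e) - 2 * f z := by
  have hg : ∀ t, HasDerivAt (fun t => f (z + t) + f (z - t) - m * t ^ 2)
      (f1 (z + t) - f1 (z - t) - 2 * m * t) t := fun t => by
    have h1 := (hf (z + t)).comp_const_add z t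
    have h2 := (hf (z - t)).comp_const_sub z t
    have h3 := ((hasDerivAt_id t).pow 2).const_mul m
    exact ((h1.add h2).sub h3).congr_deriv (by simp; ring)
  obtain ⟨c, hc, hc'⟩ := exists_hasDerivAt_eq_slope _ _ he
    (fun t _ => (hg t).continuousAt.continuousWithinAt) fun t _ => hg t
  obtain ⟨ξ, hξ, hξ'⟩ := exists_hasDerivAt_eq_slope f1 f2 (by linarith [hc.1] : z - c < z + c)
    (fun t _ => (hf1 t).continuousAt.continuousWithinAt) fun t _ => hf1 t
  have hmξ := hm ξ ⟨by linarith [hξ.1, hc.2], by linarith [hξ.2, hc.2]⟩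
  rw [eq_div_iff (by linarith [hc.1])] at hξ'
  rw [eq_div_iff (by linarith)] at hc'
  simp only [add_zero, sub_zero] at hc'
  have h1 : 0 ≤ f1 (z + c) - f1 (z - c) - 2 * m * c := by nlinarith [hc.1]
  nlinarith

theorem eventually_rpow_neg_le (σ : ℝ) {δ : ℝ} (hδ : 0 < δ) :
    ∀ᶠ e : ℝ in 𝓝 0, (1 + e ^ 2) ^ (-σ) ≤ 1 - (σ - δ) * e ^ 2 := by
  have h : HasDerivAt (fun x : ℝ => (1 + x) ^ (-σ)) (-σ) 0 := by
    have h0 := ((hasDerivAt_id (0 : ℝ)).const_add 1).rpow_const (p := -σ) (by simp)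
    simpa using h0
  have h2 := (hasDerivAt_iff_isLittleO.1 h).def hδ
  have ht : Tendsto (fun e : ℝ => e ^ 2) (𝓝 0) (𝓝 0) := by
    have := (continuous_pow 2 : Continuous fun e : ℝ => e ^ 2).tendsto 0
    simpa using this
  filter_upwards [ht.eventually h2] with e he
  simp only [add_zero, Real.one_rpow, sub_zero, smul_eq_mul, Real.norm_eq_abs] at he
  rw [abs_of_nonneg (sq_nonneg e)] at he
  linarith [(abs_le.1 he).2]

/-- First order in `e²`, since `√(1 + e²) - 1 = e² / (√(1 + e²) + 1)`. The neighbourhood is joint in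
`(e, y)` so that compactness can later make the bound uniform in `y`. -/
theorem eventually_dilation_ge {f f1 : ℝ → ℝ} (hf : ∀ y, HasDerivAt f (f1 y) y)
    (hf1 : Continuous f1) (y₀ : ℝ) {δ : ℝ} (hδ : 0 < δ) :
    ∀ᶠ p : ℝ × ℝ in 𝓝 (0, y₀),
      p.1 ^ 2 * (y₀ * f1 y₀ / 2 - δ) ≤ f (p.2 * √(1 + p.1 ^ 2)) - f p.2 := by
  have hF : Continuous fun p : ℝ × ℝ × ℝ => p.1 * f1 p.2.1 * p.2.2 := by fun_prop
  have h0 : ∀ᶠ p : ℝ × ℝ × ℝ in 𝓝 (y₀, y₀, 1 / 2),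
      y₀ * f1 y₀ / 2 - δ < p.1 * f1 p.2.1 * p.2.2 :=
    hF.continuousAt.eventually (lt_mem_nhds (by dsimp only; linarith))
  obtain ⟨η, hη, h⟩ := Metric.eventually_nhds_iff.1 h0
  have c1 : Continuous fun p : ℝ × ℝ => p.2 := continuous_snd
  have c2 : Continuous fun p : ℝ × ℝ => p.2 * √(1 + p.1 ^ 2) := by fun_prop
  have c3 : Continuous fun p : ℝ × ℝ => 1 / (√(1 + p.1 ^ 2) + 1) :=
    continuous_const.div (by fun_prop) fun p => by positivity
  have e1 : ∀ᶠ p : ℝ × ℝ in 𝓝 (0, y₀), p.2 ∈ Metric.ball y₀ η :=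
    c1.continuousAt.eventually (Metric.ball_mem_nhds _ hη)
  have e2 : ∀ᶠ p : ℝ × ℝ in 𝓝 (0, y₀), p.2 * √(1 + p.1 ^ 2) ∈ Metric.ball y₀ η :=
    (c2.tendsto' (0, y₀) y₀ (by simp)).eventually (Metric.ball_mem_nhds y₀ hη)
  have e3 : ∀ᶠ p : ℝ × ℝ in 𝓝 (0, y₀),
      1 / (√(1 + p.1 ^ 2) + 1) ∈ Metric.ball (1 / 2 : ℝ) η :=
    (c3.tendsto' (0, y₀) (1 / 2) (by norm_num)).eventually
      (Metric.ball_mem_nhds (1 / 2 : ℝ) hη)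
  filter_upwards [e1, e2, e3] with ⟨e, y⟩ h1 h2 h3
  dsimp only at h1 h2 h3 ⊢
  obtain ⟨ξ, hξ, hξ'⟩ : ∃ ξ ∈ Metric.ball y₀ η, f (y * √(1 + e ^ 2)) - f y =
      (y * √(1 + e ^ 2) - y) * f1 ξ := by
    rcases lt_trichotomy y (y * √(1 + e ^ 2)) with hlt | heq | hgt
    · obtain ⟨ξ, hξ, hξ'⟩ := exists_hasDerivAt_eq_slope f f1 hlt
        (fun t _ => (hf t).continuousAt.continuousWithinAt) fun t _ => hf t
      refine ⟨ξ, (convex_ball y₀ η).ordConnected.out h1 h2 ⟨hξ.1.le, hξ.2.le⟩, ?_⟩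
      rw [hξ', mul_div_cancel₀ _ (by linarith)]
    · exact ⟨y, h1, by rw [← heq]; simp⟩
    · obtain ⟨ξ, hξ, hξ'⟩ := exists_hasDerivAt_eq_slope f f1 hgt
        (fun t _ => (hf t).continuousAt.continuousWithinAt) fun t _ => hf t
      refine ⟨ξ, (convex_ball y₀ η).ordConnected.out h2 h1 ⟨hξ.1.le, hξ.2.le⟩, ?_⟩
      rw [hξ', ← neg_sub (y * _) y, div_neg, mul_neg, mul_div_cancel₀ _ (by linarith)]
      ring
  have hb := @h (y, ξ, 1 / (√(1 + e ^ 2) + 1)) (by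
    rw [Prod.dist_eq, Prod.dist_eq, max_lt_iff, max_lt_iff]
    exact ⟨h1, hξ, h3⟩)
  dsimp only at hb
  have hs : y * √(1 + e ^ 2) - y = e ^ 2 * (y * (1 / (√(1 + e ^ 2) + 1))) := by
    have := Real.sq_sqrt (by positivity : 0 ≤ 1 + e ^ 2)
    have hp : 0 < √(1 + e ^ 2) + 1 := by positivity
    field_simp
    linear_combination y * this
  rw [hξ', hs]
  nlinarith [mul_le_mul_of_nonneg_left hb.le (sq_nonneg e)]

theorem eventually_second_difference_ge {f f1 f2 : ℝ → ℝ} (hf : ∀ y, HasDerivAt f (f1 y) y)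
    (hf1 : ∀ y, HasDerivAt f1 (f2 y) y) (hf2 : Continuous f2) (y₀ : ℝ) {δ : ℝ} (hδ : 0 < δ) :
    ∀ᶠ p : ℝ × ℝ in 𝓝 (0, y₀), 0 < p.1 →
      p.1 ^ 2 * (f2 y₀ - δ) ≤ f (p.2 * √(1 + p.1 ^ 2) + p.1) + f (p.2 * √(1 + p.1 ^ 2) - p.1)
        - 2 * f (p.2 * √(1 + p.1 ^ 2)) := by
  have h0 : ∀ᶠ ξ in 𝓝 y₀, f2 y₀ - δ < f2 ξ :=
    hf2.continuousAt.eventually (lt_mem_nhds (by linarith))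
  obtain ⟨η, hη, h⟩ := Metric.eventually_nhds_iff.1 h0
  have c1 : Continuous fun p : ℝ × ℝ => p.2 * √(1 + p.1 ^ 2) + p.1 := by fun_prop
  have c2 : Continuous fun p : ℝ × ℝ => p.2 * √(1 + p.1 ^ 2) - p.1 := by fun_prop
  have e1 : ∀ᶠ p : ℝ × ℝ in 𝓝 (0, y₀), p.2 * √(1 + p.1 ^ 2) + p.1 ∈ Metric.ball y₀ η :=
    (c1.tendsto' (0, y₀) y₀ (by simp)).eventually (Metric.ball_mem_nhds y₀ hη)
  have e2 : ∀ᶠ p : ℝ × ℝ in 𝓝 (0, y₀), p.2 * √(1 + p.1 ^ 2) - p.1 ∈ Metric.ball y₀ η :=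
    (c2.tendsto' (0, y₀) y₀ (by simp)).eventually (Metric.ball_mem_nhds y₀ hη)
  filter_upwards [e1, e2] with p h1 h2 hp
  exact second_difference_ge hf hf1 hp fun ξ hξ =>
    (h ((convex_ball y₀ η).ordConnected.out h2 h1 hξ)).le

/-- Intended for `e = 1 / √T`, `y = x / √(T + 1)`: then `y √(1 + e²) = x / √T`, and `(1 + e²) ^
(-σ)` is the ratio of the time prefactors. The three expansions add up to `e² / 2` times the
quantity in `hL`. -/
theorem eventually_discrete_subsolution {f f1 f2 : ℝ → ℝ} (hf : ∀ y, HasDerivAt f (f1 y) y)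
    (hf1 : ∀ y, HasDerivAt f1 (f2 y) y) (hf2 : Continuous f2) {σ a y₀ : ℝ} (hσ : 0 ≤ σ)
    (ha : 0 ≤ a) (hL : 0 < 2 * σ * f y₀ + y₀ * f1 y₀ + a * f2 y₀) :
    ∀ᶠ p : ℝ × ℝ in 𝓝 (0, y₀), 0 < p.1 → 0 ≤ f p.2 →
      (1 + p.1 ^ 2) ^ (-σ) * f p.2 ≤ (1 - a) * f (p.2 * √(1 + p.1 ^ 2)) +
        a * ((f (p.2 * √(1 + p.1 ^ 2) + p.1) + f (p.2 * √(1 + p.1 ^ 2) - p.1)) / 2) := by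
  set L := 2 * σ * f y₀ + y₀ * f1 y₀ + a * f2 y₀ with hLdef
  -- Total weight of the `δ` errors: `σ` from moving `y₀`, `|f y₀| + 1` from the prefactor, `1` from
  -- the dilation, `a / 2` from the second difference.
  set B := σ + |f y₀| + 2 + a / 2 with hB
  have hB0 : 0 < B := by positivity
  obtain ⟨δ, hδ, hδ1, hδB⟩ : ∃ δ : ℝ, 0 < δ ∧ δ ≤ 1 ∧ δ * B ≤ L / 2 :=
    ⟨min 1 (L / 2 / B), lt_min one_pos (by positivity), min_le_left _ _, by
      rw [← le_div_iff₀ hB0]; exact min_le_right _ _⟩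
  have hcf : Continuous f := continuous_iff_continuousAt.2 fun y => (hf y).continuousAt
  have hcf1 : Continuous f1 := continuous_iff_continuousAt.2 fun y => (hf1 y).continuousAt
  have e1 : ∀ᶠ p : ℝ × ℝ in 𝓝 (0, y₀), (1 + p.1 ^ 2) ^ (-σ) ≤ 1 - (σ - δ) * p.1 ^ 2 :=
    (continuous_fst.continuousAt (x := ((0 : ℝ), y₀))).eventually (eventually_rpow_neg_le σ hδ)
  have e4 : ∀ᶠ p : ℝ × ℝ in 𝓝 (0, y₀), |f p.2 - f y₀| < δ :=
    ((hcf.comp continuous_snd).continuousAt (x := ((0 : ℝ), y₀))).eventually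
      (Metric.ball_mem_nhds _ hδ)
  filter_upwards [e1, eventually_dilation_ge hf hcf1 y₀ hδ,
    eventually_second_difference_ge hf hf1 hf2 y₀ hδ, e4] with p h1 h2 h3 h4 hp hfp
  have h3 := h3 hp
  have h4 := abs_lt.1 h4
  have h5 := mul_le_mul_of_nonneg_right h1 hfp
  have h6 := mul_le_mul_of_nonneg_left h3 ha
  have hA := le_abs_self (f y₀)
  have h7 : 0 ≤ (σ - δ) * f p.2 + y₀ * f1 y₀ / 2 - δ + a * (f2 y₀ - δ) / 2 := by
    have h8 : σ * (f y₀ - δ) ≤ σ * f p.2 := mul_le_mul_of_nonneg_left (by linarith) hσ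
    have h9 : δ * f p.2 ≤ δ * (|f y₀| + 1) := mul_le_mul_of_nonneg_left (by linarith) hδ.le
    rw [hB] at hδB
    nlinarith
  nlinarith [mul_nonneg (sq_nonneg p.1) h7]

/-! ### From a strict profile to a lower bound -/

/-- The self-similar profile `f` at time `T`, truncated at zero. -/
noncomputable def profileValue (f : ℝ → ℝ) (σ : ℝ) (T : ℕ) (x : ℤ) : ℝ :=
  (T : ℝ) ^ (-σ) * max (f (x / √T)) 0

/-- `f` is a strict compactly supported self-similar subsolution of exponent `σ`, where at each
point one may choose between diffusivity `1` and diffusivity `1 - q`. -/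
structure IsSubProfile (q σ : ℝ) (f f1 f2 : ℝ → ℝ) : Prop where
  hasDerivAt : ∀ y, HasDerivAt f (f1 y) y
  hasDerivAt_deriv : ∀ y, HasDerivAt f1 (f2 y) y
  continuous_snd : Continuous f2
  pos : 0 < f 0
  nonpos : ∃ M : ℝ, ∀ y, M ≤ |y| → f y ≤ 0
  strict : ∀ y, 0 ≤ f y → 0 < 2 * σ * f y + y * f1 y + f2 y ∨
    0 < 2 * σ * f y + y * f1 y + (1 - q) * f2 y

namespace IsSubProfile

variable {q σ : ℝ} {f f1 f2 : ℝ → ℝ}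

theorem continuous (h : IsSubProfile q σ f f1 f2) : Continuous f :=
  continuous_iff_continuousAt.2 fun y => (h.hasDerivAt y).continuousAt

theorem eventually_le (h : IsSubProfile q σ f f1 f2) (hq : q ∈ Set.Ioo (0 : ℝ) 1) (hσ : 0 ≤ σ) :
    ∀ᶠ e : ℝ in 𝓝 0, 0 < e → ∀ y, 0 < f y →
      (1 + e ^ 2) ^ (-σ) * f y ≤
        max ((f (y * √(1 + e ^ 2) + e) + f (y * √(1 + e ^ 2) - e)) / 2)
          (q * f (y * √(1 + e ^ 2)) +
            (1 - q) * ((f (y * √(1 + e ^ 2) + e) + f (y * √(1 + e ^ 2) - e)) / 2)) := by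
  obtain ⟨M, hM⟩ := h.nonpos
  -- Strictness holds on the closed set `f ≥ 0`, zeros included; its compactness yields one
  -- threshold for `e`.
  have hK : IsCompact (Set.Icc (-M) M ∩ {y | 0 ≤ f y}) :=
    isCompact_Icc.inter_right (isClosed_le continuous_const h.continuous)
  have key := hK.eventually_forall_of_forall_eventually (x₀ := (0 : ℝ))
    (P := fun e y => 0 < e → 0 ≤ f y → (1 + e ^ 2) ^ (-σ) * f y ≤
        max ((f (y * √(1 + e ^ 2) + e) + f (y * √(1 + e ^ 2) - e)) / 2)
          (q * f (y * √(1 + e ^ 2)) +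
            (1 - q) * ((f (y * √(1 + e ^ 2) + e) + f (y * √(1 + e ^ 2) - e)) / 2))) (by
      rintro y ⟨-, hy⟩
      rcases h.strict y hy with hs | hs
      · rw [← one_mul (f2 y)] at hs
        filter_upwards [eventually_discrete_subsolution h.hasDerivAt h.hasDerivAt_deriv
          h.continuous_snd hσ zero_le_one hs] with p hp h1 h2
        refine (hp h1 h2).trans (le_trans (le_of_eq ?_) (le_max_left _ _))
        ring
      · filter_upwards [eventually_discrete_subsolution h.hasDerivAt h.hasDerivAt_deriv
          h.continuous_snd hσ (sub_nonneg.2 hq.2.le) hs] with p hp h1 h2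
        refine (hp h1 h2).trans (le_trans (le_of_eq ?_) (le_max_right _ _))
        ring)
  filter_upwards [key] with e he he0 y hy
  have hyM : |y| < M := by
    by_contra hc
    exact absurd (hM y (not_lt.1 hc)) (not_le.2 hy)
  exact he y ⟨abs_le.1 hyM.le, hy.le⟩ he0 hy.le

theorem eventually_profileValue_le (h : IsSubProfile q σ f f1 f2) (hq : q ∈ Set.Ioo (0 : ℝ) 1)
    (hσ : 0 ≤ σ) :
    ∀ᶠ T : ℕ in atTop, ∀ x, profileValue f σ (T + 1) x ≤ bestStep q (profileValue f σ T) x := by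
  have ht : Tendsto (fun T : ℕ => 1 / √(T : ℝ)) atTop (𝓝 0) := by
    simp only [one_div]
    exact tendsto_inv_atTop_zero.comp (Real.tendsto_sqrt_atTop.comp tendsto_natCast_atTop_atTop)
  filter_upwards [ht.eventually (h.eventually_le hq hσ), eventually_ge_atTop 1] with T hT hT1 x
  have hT0 : (0 : ℝ) < T := by exact_mod_cast hT1
  have hs0 : 0 < √(T : ℝ) := Real.sqrt_pos.2 hT0
  have hs1 : 0 < √((T : ℝ) + 1) := Real.sqrt_pos.2 (by linarith)
  have hP : ∀ x, 0 ≤ profileValue f σ T x := fun x =>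
    mul_nonneg (Real.rpow_nonneg hT0.le _) (le_max_right _ _)
  -- Where the new profile is not positive, truncation makes the left side `0`.
  by_cases hpos : 0 < f (x / √((T : ℝ) + 1))
  · have hle := hT (by positivity) _ hpos
    have e1 : 1 + (1 / √(T : ℝ)) ^ 2 = (T + 1) / T := by
      rw [div_pow, Real.sq_sqrt hT0.le]; field_simp
    have e2 : (x : ℝ) / √((T : ℝ) + 1) * √((T + 1) / T) = x / √T := by
      rw [Real.sqrt_div (by linarith)]; field_simp
    have e3 : (x : ℝ) / √T + 1 / √T = (x + 1) / √T := by ring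
    have e4 : (x : ℝ) / √T - 1 / √T = (x - 1) / √T := by ring
    rw [e1, e2, e3, e4, Real.div_rpow (by linarith) hT0.le] at hle
    have hp : 0 < (T : ℝ) ^ (-σ) := Real.rpow_pos_of_pos hT0 _
    have hle' : ((T : ℝ) + 1) ^ (-σ) * f (x / √((T : ℝ) + 1)) ≤ (T : ℝ) ^ (-σ) *
        max ((f ((x + 1) / √T) + f ((x - 1) / √T)) / 2)
          (q * f (x / √T) + (1 - q) * ((f ((x + 1) / √T) + f ((x - 1) / √T)) / 2)) := by
      have := mul_le_mul_of_nonneg_left hle hp.le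
      rwa [div_mul_eq_mul_div, mul_div_cancel₀ _ hp.ne'] at this
    have hV : profileValue f σ (T + 1) x = ((T : ℝ) + 1) ^ (-σ) * f (x / √((T : ℝ) + 1)) := by
      simp [profileValue, max_eq_left hpos.le]
    rw [hV]
    refine hle'.trans ?_
    have hm : ∀ x, (T : ℝ) ^ (-σ) * f ((x : ℤ) / √T) ≤ profileValue f σ T x := fun x =>
      mul_le_mul_of_nonneg_left (le_max_left _ _) hp.le
    have m0 := hm x
    have m1 := hm (x + 1)
    have m2 := hm (x - 1)
    push_cast at m1 m2
    rw [mul_max_of_nonneg _ _ hp.le]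
    refine max_le_max (by linarith) ?_
    have h1q : 0 ≤ 1 - q := sub_nonneg.2 hq.2.le
    nlinarith [mul_le_mul_of_nonneg_left m0 hq.1.le, mul_le_mul_of_nonneg_left m1 h1q,
      mul_le_mul_of_nonneg_left m2 h1q]
  · have hV : profileValue f σ (T + 1) x = 0 := by
      simp [profileValue, max_eq_right (not_lt.1 hpos)]
    rw [hV]
    exact le_trans (by linarith [hP (x + 1), hP (x - 1)]) (le_max_left _ _)

end IsSubProfile

theorem bestStep_const_mul {q : ℝ} {c : ℝ} (hc : 0 ≤ c) (v : ℤ → ℝ) (x : ℤ) :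
    bestStep q (fun x => c * v x) x = c * bestStep q v x := by
  simp only [bestStep]
  rw [mul_max_of_nonneg _ _ hc]
  congr 1 <;> ring

/-- The lazy branch gives all three steps positive weight, so parity is no obstruction. -/
theorem valueFn_pos {q : ℝ} (hq : q ∈ Set.Ioo (0 : ℝ) 1) {n : ℕ} {x : ℤ} (hx : |x| ≤ n) :
    0 < valueFn q n x := by
  induction n generalizing x with
  | zero =>
    have : x = 0 := by simpa using hx
    simp [valueFn, this]
  | succ n ih =>
    have h0 := fun y => (valueFn_mem_Icc hq n y).1
    have h1q : 0 < 1 - q := sub_pos.2 hq.2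
    refine lt_of_lt_of_le ?_ (le_max_right _ _)
    have hx' := abs_le.1 hx
    push_cast at hx'
    rcases lt_trichotomy x 0 with h | h | h
    · have := ih (x := x + 1) (abs_le.2 ⟨by omega, by omega⟩)
      nlinarith [mul_nonneg hq.1.le (h0 x), h0 (x - 1), mul_pos h1q this,
        mul_nonneg h1q.le (h0 (x - 1))]
    · have := ih (x := x) (by simp [h])
      nlinarith [mul_pos hq.1 this, mul_nonneg h1q.le (h0 (x - 1)),
        mul_nonneg h1q.le (h0 (x + 1))]
    · have := ih (x := x - 1) (abs_le.2 ⟨by omega, by omega⟩)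
      nlinarith [mul_nonneg hq.1.le (h0 x), mul_pos h1q this, mul_nonneg h1q.le (h0 (x + 1))]

theorem IsSubProfile.exists_lt_valueFn {q σ : ℝ} {f f1 f2 : ℝ → ℝ}
    (h : IsSubProfile q σ f f1 f2) (hq : q ∈ Set.Ioo (0 : ℝ) 1) (hσ : 0 ≤ σ) :
    ∃ c : ℝ, 0 < c ∧ ∀ n : ℕ, 1 ≤ n → c * (n : ℝ) ^ (-σ) < valueFn q n 0 := by
  obtain ⟨T, hT⟩ := eventually_atTop.1 ((h.eventually_profileValue_le hq hσ).and
    (eventually_ge_atTop 1))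
  have hT1 := (hT T le_rfl).2
  have hT0 : (0 : ℝ) < T := by exact_mod_cast hT1
  obtain ⟨M, hM⟩ := h.nonpos
  -- `K ≥ M √T` confines the profile to `[-K, K]`, where `valueFn q K` is positive; `K ≥ T` gives
  -- `(K + j) ^ (-σ) ≤ (T + j) ^ (-σ)`.
  obtain ⟨K, hK⟩ : ∃ K : ℕ, T ≤ K ∧ M * √T ≤ K :=
    ⟨max T ⌈M * √T⌉₊, le_max_left _ _, (Nat.le_ceil _).trans (by exact_mod_cast le_max_right _ _)⟩
  have hsupp : ∀ x : ℤ, (K : ℤ) < |x| → profileValue f σ T x = 0 := by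
    intro x hx
    have : f (x / √T) ≤ 0 := by
      refine hM _ ?_
      rw [abs_div, abs_of_pos (Real.sqrt_pos.2 hT0), le_div_iff₀ (Real.sqrt_pos.2 hT0)]
      have : (K : ℝ) < |(x : ℝ)| := by exact_mod_cast hx
      linarith [hK.2]
    simp [profileValue, max_eq_right this]
  obtain ⟨c, hc, hcV⟩ : ∃ c : ℝ, 0 < c ∧ ∀ x, c * profileValue f σ T x ≤ valueFn q K x := by
    have hfin : ∀ s : Finset ℤ, (∀ x ∈ s, |x| ≤ (K : ℤ)) →
        ∃ c : ℝ, 0 < c ∧ ∀ x ∈ s, c * profileValue f σ T x ≤ valueFn q K x := by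
      intro s hs
      have hev : ∀ᶠ c : ℝ in 𝓝[>] 0, ∀ x ∈ s, c * profileValue f σ T x ≤ valueFn q K x := by
        rw [Filter.eventually_all_finset]
        intro x hx
        have hct : Tendsto (fun c : ℝ => c * profileValue f σ T x) (𝓝[>] 0) (𝓝 0) := by
          have : Continuous fun c : ℝ => c * profileValue f σ T x := by fun_prop
          simpa using (this.tendsto 0).mono_left nhdsWithin_le_nhds
        exact (hct.eventually (gt_mem_nhds (valueFn_pos hq (hs x hx)))).mono fun _ h => h.le
      obtain ⟨c, h1, h2⟩ := (hev.and self_mem_nhdsWithin).exists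
      exact ⟨c, h2, h1⟩
    obtain ⟨c, hc, h1⟩ := hfin (Finset.Icc (-(K : ℤ)) K) fun x hx => by
      rw [Finset.mem_Icc] at hx; exact abs_le.2 hx
    refine ⟨c, hc, fun x => ?_⟩
    rcases le_or_gt |x| (K : ℤ) with hx | hx
    · exact h1 x (Finset.mem_Icc.2 (abs_le.1 hx))
    · rw [hsupp x hx, mul_zero]
      exact (valueFn_mem_Icc hq K x).1
  have hiter : ∀ j x, c * profileValue f σ (T + j) x ≤ valueFn q (K + j) x := by
    intro j
    induction j with
    | zero => exact hcV
    | succ j ih =>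
      intro x
      have h1 := mul_le_mul_of_nonneg_left ((hT (T + j) (Nat.le_add_right _ _)).1 x) hc.le
      rw [← bestStep_const_mul hc.le] at h1
      exact h1.trans (bestStep_mono hq ih x)
  -- Never leaving the origin: a crude bound for the times `n ≤ K`.
  have hq0 : ∀ n, q ^ n ≤ valueFn q n 0 := by
    intro n
    induction n with
    | zero => simp [valueFn]
    | succ n ih =>
      refine le_trans ?_ (le_max_right _ _)
      have h0 := fun y => (valueFn_mem_Icc hq n y).1
      rw [pow_succ']
      have h1q : 0 ≤ 1 - q := sub_nonneg.2 hq.2.le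
      exact le_add_of_le_of_nonneg (mul_le_mul_of_nonneg_left ih hq.1.le)
        (mul_nonneg h1q (div_nonneg (add_nonneg (h0 _) (h0 _)) zero_le_two))
  have hqK : 0 < q ^ K := pow_pos hq.1 K
  have hcf : 0 < c * f 0 := mul_pos hc h.pos
  refine ⟨min (c * f 0) (q ^ K) / 2, by positivity, fun n hn => ?_⟩
  have hn0 : (0 : ℝ) < n := by exact_mod_cast hn
  have hnp : 0 < (n : ℝ) ^ (-σ) := Real.rpow_pos_of_pos hn0 _
  have hmin : 0 < min (c * f 0) (q ^ K) := lt_min hcf hqK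
  refine lt_of_lt_of_le (b := min (c * f 0) (q ^ K) * (n : ℝ) ^ (-σ)) (by nlinarith) ?_
  rcases le_total n K with hnK | hnK
  · have h1 : (n : ℝ) ^ (-σ) ≤ 1 :=
      Real.rpow_le_one_of_one_le_of_nonpos (by exact_mod_cast hn) (by linarith)
    calc min (c * f 0) (q ^ K) * (n : ℝ) ^ (-σ) ≤ q ^ K * 1 :=
          mul_le_mul (min_le_right _ _) h1 hnp.le hqK.le
      _ ≤ q ^ n := by rw [mul_one]; exact pow_le_pow_of_le_one hq.1.le hq.2.le hnK
      _ ≤ _ := hq0 n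
  · obtain ⟨j, rfl⟩ := Nat.exists_eq_add_of_le hnK
    refine le_trans ?_ (hiter j 0)
    have hTj : (0 : ℝ) < ((T + j : ℕ) : ℝ) := by exact_mod_cast (by omega : 0 < T + j)
    have h1 : ((K + j : ℕ) : ℝ) ^ (-σ) ≤ ((T + j : ℕ) : ℝ) ^ (-σ) :=
      Real.rpow_le_rpow_of_nonpos hTj (by exact_mod_cast (by omega : T + j ≤ K + j)) (by linarith)
    have h2 : profileValue f σ (T + j) 0 = ((T + j : ℕ) : ℝ) ^ (-σ) * f 0 := by
      simp [profileValue, max_eq_left h.pos.le]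
    rw [h2]
    calc min (c * f 0) (q ^ K) * ((K + j : ℕ) : ℝ) ^ (-σ)
        ≤ c * f 0 * ((T + j : ℕ) : ℝ) ^ (-σ) :=
          mul_le_mul (min_le_left _ _) h1 hnp.le hcf.le
      _ = _ := by ring

/-! ### The perturbed heat kernel profile -/

theorem hasDerivAt_exp_neg_mul_sq (l y : ℝ) :
    HasDerivAt (fun y => Real.exp (-(l * y ^ 2))) (-(2 * l * y) * Real.exp (-(l * y ^ 2))) y := by
  have h := (((hasDerivAt_id y).pow 2).const_mul l).neg.exp
  exact h.congr_deriv (by simp; ring)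

theorem hasDerivAt_deriv_exp_neg_mul_sq (l y : ℝ) :
    HasDerivAt (fun y => -(2 * l * y) * Real.exp (-(l * y ^ 2)))
      ((4 * l ^ 2 * y ^ 2 - 2 * l) * Real.exp (-(l * y ^ 2))) y := by
  have h := (((hasDerivAt_id y).const_mul (2 * l)).neg).mul (hasDerivAt_exp_neg_mul_sq l y)
  exact h.congr_deriv (by simp; ring)

/-- The two expressions are `2σ f + y f' + a f''` for `a = 1` and `a = 1 - q`. For `y² ≤ 3/4` the
concavity gain `q (1 - y²) E1 ≥ 8192 ε E1` outweighs all corrections. For `3/4 ≤ y² ≤ 4` the `E2`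
term gives at least `8ε` against losses of at most `4ε`. Beyond, the `E3` term repays `-2ε E1`. -/
theorem gaussianProfile_strict {q y : ℝ} (hq : q ∈ Set.Ioo (0 : ℝ) 1) {ε : ℝ}
    (hε : ε = q / 32768) {E1 E2 E3 : ℝ} (hE1 : E1 = Real.exp (-(1 / 2 * y ^ 2)))
    (hE2 : E2 = Real.exp (-(1 * y ^ 2))) (hE3 : E3 = Real.exp (-(1 / 4 * y ^ 2))) :
    0 < -(2 * ε) * E1 + 2048 * ε * (2 * y ^ 2 - 1 - 2 * ε) * E2 +
        4 * ε * (y ^ 2 / 4 - 1 / 2 + 2 * ε) * E3 ∨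
    0 < -(2 * ε) * E1 + 2048 * ε * (2 * y ^ 2 - 1 - 2 * ε) * E2 +
        4 * ε * (y ^ 2 / 4 - 1 / 2 + 2 * ε) * E3 -
        q * ((y ^ 2 - 1) * E1 + 2048 * ε * (4 * y ^ 2 - 2) * E2 -
          4 * ε * (y ^ 2 / 4 - 1 / 2) * E3) := by
  obtain ⟨hq0, hq1⟩ := hq
  have hq' : q = 32768 * ε := by rw [hε]; ring
  have hε0 : 0 < ε := by rw [hε]; linarith
  have hε1 : ε < 1 / 32768 := by rw [hε]; linarith
  have p1 : 0 < E1 := hE1 ▸ Real.exp_pos _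
  have p2 : 0 < E2 := hE2 ▸ Real.exp_pos _
  have p3 : 0 < E3 := hE3 ▸ Real.exp_pos _
  have l21 : E2 ≤ E1 := by rw [hE1, hE2, Real.exp_le_exp]; nlinarith [sq_nonneg y]
  have l13 : E1 ≤ E3 := by rw [hE1, hE3, Real.exp_le_exp]; nlinarith [sq_nonneg y]
  have b3 : E3 ≤ 1 := by rw [hE3, Real.exp_le_one_iff]; nlinarith [sq_nonneg y]
  obtain ⟨s, hs⟩ : ∃ s, s = y ^ 2 := ⟨_, rfl⟩
  have hs0 : 0 ≤ s := hs ▸ sq_nonneg y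
  rw [← hs] at hE1 hE2 hE3 ⊢
  rcases le_total s (3 / 4) with h1 | h1
  · right
    have l31 : E3 ≤ 2 * E1 := by
      have h : (1 : ℝ) / 2 ≤ Real.exp (-(1 / 4 * s)) := by
        linarith [Real.add_one_le_exp (-(1 / 4 * s))]
      have e : E1 = E3 * Real.exp (-(1 / 4 * s)) := by
        rw [hE1, hE3, ← Real.exp_add]; congr 1; ring
      rw [e]; nlinarith
    have t1 : q * ((s - 1) * E1) ≤ -(8192 * ε * E1) := by
      rw [hq']; nlinarith [mul_pos hε0 p1]
    have t2 : -(2 * E1) ≤ ((2 * s - 1) * (1 - 2 * q) - 2 * ε) * E2 := by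
      have : -2 ≤ (2 * s - 1) * (1 - 2 * q) - 2 * ε := by
        have a1 : |2 * s - 1| ≤ 1 := abs_le.2 ⟨by linarith, by linarith⟩
        have a2 : |1 - 2 * q| ≤ 1 := abs_le.2 ⟨by linarith, by linarith⟩
        have := abs_mul (2 * s - 1) (1 - 2 * q)
        have a3 : |(2 * s - 1) * (1 - 2 * q)| ≤ 1 := by
          rw [this]; exact mul_le_one₀ a1 (abs_nonneg _) a2
        linarith [(abs_le.1 a3).1]
      nlinarith
    have t3 : -(2 * E1) ≤ ((s / 4 - 1 / 2) * (1 + q) + 2 * ε) * E3 := by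
      have : -1 ≤ (s / 4 - 1 / 2) * (1 + q) + 2 * ε := by nlinarith
      nlinarith
    nlinarith [mul_le_mul_of_nonneg_left t2 hε0.le, mul_le_mul_of_nonneg_left t3 hε0.le,
      mul_pos hε0 p1]
  · left
    have hη : 1 / 4 ≤ 2 * s - 1 - 2 * ε := by linarith
    rcases le_total s 4 with h2 | h2
    · have b2 : 1 / 64 ≤ E2 := by
        have h : Real.exp (-1) ^ 4 ≤ E2 := by
          rw [hE2, ← Real.exp_nat_mul, Real.exp_le_exp]; push_cast; linarith
        have h3 : (0.36 : ℝ) ≤ Real.exp (-1) := by linarith [Real.exp_neg_one_gt_d9]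
        have h4 : (0.36 : ℝ) ^ 4 ≤ Real.exp (-1) ^ 4 := pow_le_pow_left₀ (by norm_num) h3 4
        norm_num at h4
        linarith
      have t2 : 1 / 256 ≤ (2 * s - 1 - 2 * ε) * E2 := by nlinarith
      have t3 : -(1 / 2) ≤ (s / 4 - 1 / 2 + 2 * ε) * E3 := by
        have : -(1 / 2) ≤ s / 4 - 1 / 2 + 2 * ε := by linarith
        nlinarith
      have b1 : E1 ≤ 1 := l13.trans b3
      nlinarith [mul_le_mul_of_nonneg_left t2 hε0.le, mul_le_mul_of_nonneg_left t3 hε0.le,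
        mul_le_mul_of_nonneg_left b1 hε0.le]
    · have t2 : 0 < (2 * s - 1 - 2 * ε) * E2 := mul_pos (by linarith) p2
      have t3 : 1 / 2 * E1 ≤ (s / 4 - 1 / 2 + 2 * ε) * E3 := by
        have : 1 / 2 ≤ s / 4 - 1 / 2 + 2 * ε := by linarith
        nlinarith
      nlinarith [mul_le_mul_of_nonneg_left t3 hε0.le, mul_pos hε0 t2]

/-- A perturbation of the heat kernel beats the exponent `1 / 2` for every `q`. -/
theorem isSubProfile_gaussian {q : ℝ} (hq : q ∈ Set.Ioo (0 : ℝ) 1) {ε : ℝ} (hε : ε = q / 32768) :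
    IsSubProfile q (1 / 2 - ε)
      (fun y => Real.exp (-(1 / 2 * y ^ 2)) + 2048 * ε * Real.exp (-(1 * y ^ 2)) -
        4 * ε * Real.exp (-(1 / 4 * y ^ 2)))
      (fun y => -(2 * (1 / 2) * y) * Real.exp (-(1 / 2 * y ^ 2)) +
        2048 * ε * (-(2 * 1 * y) * Real.exp (-(1 * y ^ 2))) -
        4 * ε * (-(2 * (1 / 4) * y) * Real.exp (-(1 / 4 * y ^ 2))))
      (fun y => (4 * (1 / 2) ^ 2 * y ^ 2 - 2 * (1 / 2)) * Real.exp (-(1 / 2 * y ^ 2)) +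
        2048 * ε * ((4 * 1 ^ 2 * y ^ 2 - 2 * 1) * Real.exp (-(1 * y ^ 2))) -
        4 * ε * ((4 * (1 / 4) ^ 2 * y ^ 2 - 2 * (1 / 4)) * Real.exp (-(1 / 4 * y ^ 2)))) where
  hasDerivAt y := ((hasDerivAt_exp_neg_mul_sq _ y).add
    ((hasDerivAt_exp_neg_mul_sq _ y).const_mul _)).sub
    ((hasDerivAt_exp_neg_mul_sq _ y).const_mul _)
  hasDerivAt_deriv y := ((hasDerivAt_deriv_exp_neg_mul_sq _ y).add
    ((hasDerivAt_deriv_exp_neg_mul_sq _ y).const_mul _)).sub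
    ((hasDerivAt_deriv_exp_neg_mul_sq _ y).const_mul _)
  continuous_snd := by fun_prop
  pos := by
    have : 0 < ε := by rw [hε]; linarith [hq.1]
    norm_num
    linarith
  nonpos := by
    have hε0 : 0 < ε := by rw [hε]; linarith [hq.1]
    have hε1 : ε < 1 / 32768 := by rw [hε]; linarith [hq.2]
    -- Far out the subtracted wide Gaussian wins: `y² ≥ 2 / ε` forces `exp (-y² / 4) ≤ 2ε`, and `1 +
    -- 2048 ε ≤ 2`.
    refine ⟨2 / ε, fun y hy => ?_⟩
    have hy2 : 2 / ε ≤ y ^ 2 := by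
      have h1 : 1 ≤ 2 / ε := by rw [le_div_iff₀ hε0]; linarith
      rw [← sq_abs]; nlinarith
    have p1 := Real.exp_pos (-(1 / 4 * y ^ 2))
    have h21 : Real.exp (-(1 * y ^ 2)) ≤ Real.exp (-(1 / 2 * y ^ 2)) := by
      rw [Real.exp_le_exp]; nlinarith [sq_nonneg y]
    have e : Real.exp (-(1 / 2 * y ^ 2)) =
        Real.exp (-(1 / 4 * y ^ 2)) * Real.exp (-(1 / 4 * y ^ 2)) := by
      rw [← Real.exp_add]; congr 1; ring
    have hsmall : Real.exp (-(1 / 4 * y ^ 2)) * (1 / (2 * ε)) ≤ 1 := by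
      have h1 := Real.add_one_le_exp (1 / 4 * y ^ 2)
      have h2 : Real.exp (-(1 / 4 * y ^ 2)) * Real.exp (1 / 4 * y ^ 2) = 1 := by
        rw [← Real.exp_add]; simp
      have h3 : 1 / (2 * ε) = 1 / 4 * (2 / ε) := by field_simp; norm_num
      have h4 : 1 / (2 * ε) ≤ Real.exp (1 / 4 * y ^ 2) := by rw [h3]; linarith
      exact (mul_le_mul_of_nonneg_left h4 p1.le).trans_eq h2
    rw [mul_one_div, div_le_one (by linarith)] at hsmall
    have h4 := mul_le_mul_of_nonneg_left h21 (by linarith : 0 ≤ 2048 * ε)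
    have h5 : (1 + 2048 * ε) * Real.exp (-(1 / 4 * y ^ 2)) ≤ 4 * ε := by nlinarith
    have h6 := mul_le_mul_of_nonneg_right h5 p1.le
    rw [mul_assoc, ← e] at h6
    linarith
  strict y hy := by
    rcases gaussianProfile_strict (y := y) hq hε rfl rfl rfl with h | h
    · left
      refine lt_of_lt_of_eq h ?_
      ring
    · right
      refine lt_of_lt_of_eq h ?_
      ring

/-! ### The logarithmic profile -/

/-- A logarithmic profile, whose exponent tends to `0` as `q` tends to `1`. -/
theorem isSubProfile_log {p : ℝ} (hp : 0 < p) (hp6 : p < 1 / 6) :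
    IsSubProfile (1 - p) (2 / Real.log (1 / (6 * p)))
      (fun y => -Real.log (2 * (p + y ^ 2))) (fun y => -(2 * y / (p + y ^ 2)))
      (fun y => 2 * (y ^ 2 - p) / (p + y ^ 2) ^ 2) where
  hasDerivAt y := by
    have hQ : 0 < p + y ^ 2 := by positivity
    have h := (((((hasDerivAt_id y).pow 2).const_add p).const_mul 2).log (by simp; positivity)).neg
    exact h.congr_deriv (by simp; field_simp)
  hasDerivAt_deriv y := by
    have hQ : 0 < p + y ^ 2 := by positivity
    have h := (((hasDerivAt_id y).const_mul 2).div (((hasDerivAt_id y).pow 2).const_add p)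
      (by simp; positivity)).neg
    exact h.congr_deriv (by simp; field_simp; ring)
  continuous_snd := Continuous.div (by fun_prop) (by fun_prop) fun y => by positivity
  pos := by
    have : Real.log (2 * (p + 0 ^ 2)) < 0 := Real.log_neg (by positivity) (by linarith)
    linarith
  nonpos := ⟨1, fun y hy => by
    have h1 : 1 ≤ y ^ 2 := by rw [← sq_abs]; nlinarith
    have := Real.log_nonneg (by linarith : 1 ≤ 2 * (p + y ^ 2))
    linarith⟩
  strict y hy := by
    obtain ⟨Q, hQ⟩ : ∃ Q, Q = p + y ^ 2 := ⟨_, rfl⟩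
    have hQp : p ≤ Q := by rw [hQ]; linarith [sq_nonneg y]
    have hQ0 : 0 < Q := by linarith
    have hy2 : y ^ 2 = Q - p := by rw [hQ]; ring
    have hl : 0 < Real.log (1 / (6 * p)) := Real.log_pos (by rw [lt_div_iff₀] <;> linarith)
    have hQ2 : Q ≤ 1 / 2 := by
      by_contra hc
      have := Real.log_pos (by linarith : 1 < 2 * Q)
      rw [hQ] at this
      linarith
    rw [← hQ] at hy ⊢
    have e1 : y * -(2 * y / Q) = -(2 * (Q - p) / Q) := by rw [← hy2]; ring
    rw [e1, hy2]
    -- Near the origin, `2σ f ≥ 4` pays for `y f' > -2` and `p f'' ≥ -2`; the latter amounts to `(Q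
    -- - p) (Q + 2p) ≥ 0`.
    rcases le_or_gt Q (3 * p) with h | h
    · right
      have h1 : Real.log (1 / (6 * p)) ≤ -Real.log (2 * Q) := by
        rw [one_div, Real.log_inv]
        exact neg_le_neg (Real.log_le_log (by positivity) (by linarith))
      have h2 : 4 ≤ 2 * (2 / Real.log (1 / (6 * p))) * -Real.log (2 * Q) := by
        rw [mul_div_assoc', div_mul_eq_mul_div, le_div_iff₀ hl]
        linarith
      have h3 : 2 * (Q - p) / Q < 2 := by rw [div_lt_iff₀ hQ0]; linarith
      have h4 : -2 ≤ (1 - (1 - p)) * (2 * (Q - p - p) / Q ^ 2) := by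
        rw [mul_div_assoc', le_div_iff₀ (by positivity)]
        nlinarith
      linarith
    -- Here `f ≥ 0` gives `Q ≤ 1/2`, so `y f' + f'' ≥ (Q - 3p) / Q² > 0`. This fixes the threshold
    -- `3p`, hence the `6p` in the exponent.
    · left
      have h0 : 0 ≤ 2 * (2 / Real.log (1 / (6 * p))) * -Real.log (2 * Q) := by positivity
      have h1 : -(2 * (Q - p) / Q) + 2 * (Q - p - p) / Q ^ 2 =
          2 * (Q - 2 * p - (Q - p) * Q) / Q ^ 2 := by field_simp; ring
      have h2 : 0 < 2 * (Q - 2 * p - (Q - p) * Q) / Q ^ 2 := by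
        have : (Q - p) * Q ≤ (Q - p) * (1 / 2) :=
          mul_le_mul_of_nonneg_left hQ2 (sub_nonneg.2 hQp)
        exact div_pos (by linarith) (by positivity)
      linarith

/-! ### The exponents and the conclusion -/

open scoped Classical in
/-- An exponent for the lower bound. -/
noncomputable def lowerExponent (q : ℝ) : ℝ :=
  if 1 - q < Real.exp (-4) / 6 then 2 / Real.log (1 / (6 * (1 - q))) else 1 / 2 - q / 32768

/-- The cutoff in `lowerExponent` is chosen so that `2 / log` stays below `1 / 2`. -/
theorem four_lt_log {p : ℝ} (hp : 0 < p) (h : p < Real.exp (-4) / 6) :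
    4 < Real.log (1 / (6 * p)) := by
  rw [one_div, Real.log_inv, lt_neg, Real.log_lt_iff_lt_exp (by positivity)]
  linarith

theorem lowerExponent_mem_Ioo {q : ℝ} (hq : q ∈ Set.Ioo (0 : ℝ) 1) :
    lowerExponent q ∈ Set.Ioo (0 : ℝ) (1 / 2) := by
  unfold lowerExponent
  split_ifs with h
  · have h4 := four_lt_log (sub_pos.2 hq.2) h
    refine ⟨by positivity, ?_⟩
    rw [div_lt_iff₀ (by linarith)]
    linarith
  · exact ⟨by linarith [hq.2], by linarith [hq.1]⟩

theorem exists_rpow_lowerExponent_lt_valueFn {q : ℝ} (hq : q ∈ Set.Ioo (0 : ℝ) 1) :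
    ∃ c : ℝ, 0 < c ∧ ∀ n : ℕ, 1 ≤ n → c * (n : ℝ) ^ (-lowerExponent q) < valueFn q n 0 := by
  have hσ := (lowerExponent_mem_Ioo hq).1.le
  unfold lowerExponent at hσ ⊢
  split_ifs at hσ ⊢ with h
  · have h1 : Real.exp (-4) < 1 := by simp
    have hp := isSubProfile_log (sub_pos.2 hq.2) (by linarith)
    rw [sub_sub_cancel] at hp
    exact hp.exists_lt_valueFn hq hσ
  · exact (isSubProfile_gaussian hq rfl).exists_lt_valueFn hq hσ

theorem tendsto_lowerExponent : Tendsto lowerExponent (𝓝[<] 1) (𝓝 0) := by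
  have h1 : Tendsto (fun q : ℝ => 6 * (1 - q)) (𝓝[<] 1) (𝓝[>] 0) := by
    refine tendsto_nhdsWithin_iff.2 ⟨?_, ?_⟩
    · have : Continuous fun q : ℝ => 6 * (1 - q) := by fun_prop
      exact (this.tendsto' 1 0 (by simp)).mono_left nhdsWithin_le_nhds
    · filter_upwards [self_mem_nhdsWithin] with q hq
      have : q < 1 := hq
      exact mul_pos (by norm_num) (sub_pos.2 this)
  have h2 : Tendsto (fun q : ℝ => 2 / Real.log (1 / (6 * (1 - q)))) (𝓝[<] 1) (𝓝 0) := by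
    refine Tendsto.const_div_atTop ?_ 2
    simp only [one_div]
    exact Real.tendsto_log_atTop.comp (tendsto_inv_nhdsGT_zero.comp h1)
  refine h2.congr' ?_
  have h3 : ∀ᶠ q : ℝ in 𝓝[<] 1, 1 - q < Real.exp (-4) / 6 := by
    have : Continuous fun q : ℝ => 1 - q := by fun_prop
    exact ((this.tendsto' 1 0 (by simp)).mono_left nhdsWithin_le_nhds).eventually
      (gt_mem_nhds (by positivity))
  filter_upwards [h3] with q hq
  rw [lowerExponent, if_pos hq]

theorem theorem2 :
    ∃ σp σm : ℝ → ℝ,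
      (∀ q ∈ Set.Ioo (0 : ℝ) 1,
        σp q ∈ Set.Ioo (0 : ℝ) (1 / 2) ∧ σm q ∈ Set.Ioo (0 : ℝ) (1 / 2) ∧
        ∃ c C : ℝ, 0 < c ∧ 0 < C ∧ ∀ n : ℕ, 1 ≤ n →
          c * (n : ℝ) ^ (-σm q) < supReturnProbability q n ∧
          supReturnProbability q n < C * (n : ℝ) ^ (-σp q)) ∧
      Tendsto σm (𝓝[<] 1) (𝓝 0) := by
  refine ⟨fun q => (1 - q) / 8, lowerExponent,
    fun q hq => ⟨⟨?_, ?_⟩, lowerExponent_mem_Ioo hq, ?_⟩, tendsto_lowerExponent⟩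
  · linarith [hq.2]
  · linarith [hq.1]
  · obtain ⟨c, hc, h⟩ := exists_rpow_lowerExponent_lt_valueFn hq
    refine ⟨c, 2, hc, two_pos, fun n hn => ?_⟩
    rw [supReturnProbability_eq_valueFn hq]
    exact ⟨h n hn, valueFn_lt_rpow hq hn⟩
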